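/- Let $W$ be a vector space over $\mathbb{C}$ and put $\mathcal{E}(W)=\mathrm{Hom}(W,W((x)))$, with $1_W\in\mathcal{E}(W)$ the identity operator of $W$ and, for $\alpha\in\mathbb{C}^{\times}$, $R_\alpha a(x)=a(\alpha x)$. Write $W((x_1,\dots,x_r))=W[[x_1,\dots,x_r]][x_1^{-1},\dots,x_r^{-1}]$. A finite sequence $(\psi^{(1)},\dots,\psi^{(r)})$ in $\mathcal{E}(W)$ is *quasi compatible* if there is a nonzero polynomial $p(x,y)\in\mathbb{C}[x,y]$ with $$\Big(\prod_{1\le i<j\le r}p(x_i,x_j)\Big)\psi^{(1)}(x_1)\cdots\psi^{(r)}(x_r)\in\mathrm{Hom}(W,W((x_1,\dots,x_r))).$$ A subspace of $\mathcal{E}(W)$ is quasi compatible if every finite sequence in it is; it is a *maximal* quasi compatible subspace if it is maximal under inclusion among quasi compatible subspaces. For a quasi compatible pair $(a(x),b(x))$, $\alpha\in\mathbb{C}^{\times}$ and $n\in\mathbb{Z}$, the series $a(x)_{(\alpha,n)}b(x)\in(\mathrm{End}\,W)[[x,x^{-1}]]$ is defined by $$Y_{\mathcal{E}}^{(\alpha)}(a(x),x_0)b(x)=\sum_{n\in\mathbb{Z}}\big(a(x)_{(\alpha,n)}b(x)\big)x_0^{-n-1}=\iota_{x,x_0}\big(p(x_0+\alpha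 x,x)^{-1}\big)\,\big(p(x_1,x)a(x_1)b(x)\big)\big|_{x_1=\alpha x+x_0},$$ where $p$ is any nonzero polynomial with $p(x_1,x_2)a(x_1)b(x_2)\in\mathrm{Hom}(W,W((x_1,x_2)))$ (the result does not depend on $p$), powers of $\alpha x+x_0$ are expanded in nonnegative powers of $x_0$, and $\iota_{x,x_0}$ is the expansion in $\mathbb{C}((x))((x_0))$. Put $Y_{\mathcal{E}}=Y_{\mathcal{E}}^{(1)}$ and $a(x)_nb(x)=a(x)_{(1,n)}b(x)$. A quasi compatible subspace $U$ is *closed* if $a(x)_nb(x)\in U$ for all $a(x),b(x)\in U$, $n\in\mathbb{Z}$. A *nonlocal vertex algebra* is a complex vector space $V$ with a linear map $Y(\cdot,x):V\to\mathrm{Hom}(V,V((x)))$ and a vector $\mathbf{1}\in V$ such that $Y(\mathbf{1},x)v=v$, $Y(v,x)\mathbf{1}\in V[[x]]$ and $\lim_{x\to0}Y(v,x)\mathbf{1}=v$ for $v\in V$, and such that for all $u,v,w\in V$ there is a nonnegative integer $l$ with $$(x_0+x_2)^lY(u,x_0+x_2)Y(v,x_2)w=(x_0+x_2)^lY(Y(u,x_0)v,x_2)w.$$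 A *quasi $V$-module* is a complex vector space $M$ with a linear map $Y_M(\cdot,x):V\to\mathrm{Hom}(M,M((x)))$ such that $Y_M(\mathbf{1},x)=1_M$ and such that for all $u,v\in V$, $w\in M$ there is a nonzero polynomial $f(x_1,x_2)\in\mathbb{C}[x_1,x_2]$ with $$f(x_0+x_2,x_2)Y_M(u,x_0+x_2)Y_M(v,x_2)w=f(x_0+x_2,x_2)Y_M(Y(u,x_0)v,x_2)w;$$ it is *faithful* if $Y_M$ is injective. In these identities powers of $x_0+x_2$ are expanded in nonnegative powers of $x_2$. **Theorem.** Let $V$ be a maximal quasi compatible subspace of $\mathcal{E}(W)$. Then $V$ contains $1_W$ and is closed, and $(V,Y_{\mathcal{E}},1_W)$ is a nonlocal vertex algebra with $W$ as a faithful quasi module, where the vertex operator map is $Y_W(\psi(x),x_0)=\psi(x_0)$ for $\psi(x)\in V$. Furthermore, for all $a(x),b(x)\in V$, $\alpha\in\mathbb{C}^{\times}$ and $n\in\mathbb{Z}$, $$R_\alpha a(x)=a(\alpha x)\in V\qquad\text{and}\qquad a(x)_{(\alpha,n)}b(x)\in V.$$ -/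

import Mathlib

noncomputable section

namespace NonlocalVA

universe u v

/-- `𝓔(W) = Hom(W, W((x)))`. -/
abbrev FieldSpace (W : Type u) [AddCommGroup W] [Module ℂ W] : Type u :=
  W →ₗ[ℂ] LaurentSeries W

section FieldSpace

variable {W : Type u} [AddCommGroup W] [Module ℂ W]

/-- The coefficient of `x ^ n` in `a(x)`, an endomorphism of `W`. In the usual mode notation
`a(x) = ∑ a_n x ^ (-n-1)` this is `a_{-n-1}`. -/
def coeffEnd (a : FieldSpace W) (n : ℤ) : Module.End ℂ W where
  toFun w := (a w).coeff n
  map_add' v w := by simp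
  map_smul' c w := by simp

/-- `1_W`, the identity operator of `W` as a constant series. -/
def idField (W : Type u) [AddCommGroup W] [Module ℂ W] : FieldSpace W where
  toFun w := HahnSeries.single 0 w
  map_add' v w := by simp
  map_smul' c w := by ext n; by_cases h : n = 0 <;> simp [h]

/-- The Laurent series `f(αx)`. -/
def rescaleLaurent (α : ℂˣ) (f : LaurentSeries W) : LaurentSeries W where
  coeff n := (α : ℂ) ^ n • f.coeff n
  isPWO_support' := f.isPWO_support.mono fun n hn h0 => hn (by simp [h0])

/-- `R_α a(x) = a(αx)`. -/
def rescale (α : ℂˣ) (a : FieldSpace W) : FieldSpace W where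
  toFun w := rescaleLaurent α (a w)
  map_add' v w := by ext n; simp [rescaleLaurent]
  map_smul' c w := by ext n; simpa [rescaleLaurent] using smul_comm _ c _

/-- `a(x)` as an element of `Hom(W, W[[x, x⁻¹]])`, the sequence of its coefficients. -/
def toSeries (a : FieldSpace W) : W → ℤ → W := fun w n => (a w).coeff n

end FieldSpace

section Series

variable {U : Type u} [AddCommGroup U] [Module ℂ U]

/-- Multiplication of `F ∈ U[[x₁^{±1}, …, x_r^{±1}]]`, given by its coefficients, by a
polynomial. -/
def polyMul {r : ℕ} (P : MvPolynomial (Fin r) ℂ) (F : (Fin r → ℤ) → U) : (Fin r → ℤ) → U :=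
  fun m => ∑ d ∈ P.support, P.coeff d • F (fun i => m i - (d i : ℤ))

/-- `F ∈ U((x₁, …, x_r)) = U[[x₁, …, x_r]][x₁⁻¹, …, x_r⁻¹]`. -/
def IsLaurent {r : ℕ} (F : (Fin r → ℤ) → U) : Prop :=
  ∃ N : ℤ, ∀ m : Fin r → ℤ, F m ≠ 0 → ∀ i, N ≤ m i

/-- `F(x₀ + x₂, x₂)` for `F = F(x₁, x₂)`, where `(x₀ + x₂) ^ m` is expanded in nonnegative powers
of `x₂`. The variables of the result are `x₀, x₂` in this order. For `F ∈ U((x₁))((x₂))` the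
sums are finite. -/
def substAdd (F : (Fin 2 → ℤ) → U) : (Fin 2 → ℤ) → U :=
  fun m => ∑ᶠ i : ℕ, Ring.choose (m 0 + i) i • F ![m 0 + i, m 1 - i]

/-- The coefficient of `x₀ ^ j x ^ k` in `F(αx + x₀, x)` for `F = F(x₁, x)`, where
`(αx + x₀) ^ m` is expanded in nonnegative powers of `x₀`. For `F ∈ U((x₁, x))` the sums are
finite. -/
def substScaled (α : ℂˣ) (F : (Fin 2 → ℤ) → U) (j k : ℤ) : U :=
  if 0 ≤ j then
    ∑ᶠ m : ℤ, (((Ring.choose m j.toNat : ℤ) : ℂ) * (α : ℂ) ^ (m - j)) • F ![m, k - (m - j)]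
  else 0

end Series

/-- The inverse of `p(x₀ + αx, x)` in the field `K((x₀))`, for an extension `c : ℂ → K` of fields
and `x ∈ K`. -/
def invSubst {K : Type u} [Field K] (c : ℂ →+* K) (x : K) (α : ℂˣ)
    (p : MvPolynomial (Fin 2) ℂ) : LaurentSeries K :=
  (MvPolynomial.eval₂Hom ((HahnSeries.C : K →+* LaurentSeries K).comp c)
    ![HahnSeries.single 1 1 + HahnSeries.C (c α * x), HahnSeries.C x] p)⁻¹

/-- `ι_{x,x₀} (p(x₀ + αx, x)⁻¹) ∈ ℂ((x))((x₀))`: the inner Laurent series are in `x`, the outer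
ones in `x₀`. -/
def iotaInv (α : ℂˣ) (p : MvPolynomial (Fin 2) ℂ) : LaurentSeries (LaurentSeries ℂ) :=
  invSubst (HahnSeries.C : ℂ →+* LaurentSeries ℂ) (HahnSeries.single 1 1) α p

section Compatible

variable {W : Type u} [AddCommGroup W] [Module ℂ W]

/-- The coefficients of `ψ⁽¹⁾(x₁) ⋯ ψ⁽ʳ⁾(x_r) w`. -/
def prodSeries {r : ℕ} (ψ : Fin r → FieldSpace W) (w : W) : (Fin r → ℤ) → W :=
  fun m => (List.ofFn fun i => coeffEnd (ψ i) (m i)).prod w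

/-- `∏_{i<j} p(x_i, x_j)`. -/
def pairProd (r : ℕ) (p : MvPolynomial (Fin 2) ℂ) : MvPolynomial (Fin r) ℂ :=
  ∏ ij ∈ Finset.univ.filter (fun ij : Fin r × Fin r => ij.1 < ij.2),
    MvPolynomial.rename ![ij.1, ij.2] p

/-- An ordered sequence is quasi compatible if
`(∏_{i<j} p(x_i, x_j)) ψ⁽¹⁾(x₁) ⋯ ψ⁽ʳ⁾(x_r) ∈ Hom(W, W((x₁, …, x_r)))`
for some nonzero polynomial `p`. -/
def QuasiCompatibleSeq {r : ℕ} (ψ : Fin r → FieldSpace W) : Prop :=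
  ∃ p : MvPolynomial (Fin 2) ℂ, p ≠ 0 ∧
    ∀ w, IsLaurent (polyMul (pairProd r p) (prodSeries ψ w))

/-- A set is quasi compatible if every finite sequence in it is. -/
def QuasiCompatible (S : Set (FieldSpace W)) : Prop :=
  ∀ (r : ℕ) (ψ : Fin r → FieldSpace W), (∀ i, ψ i ∈ S) → QuasiCompatibleSeq ψ

/-- `p` is nonzero and `p(x₁, x₂) a(x₁) b(x₂) ∈ Hom(W, W((x₁, x₂)))`. -/
def Regularizes (p : MvPolynomial (Fin 2) ℂ) (a b : FieldSpace W) : Prop :=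
  p ≠ 0 ∧ ∀ w, IsLaurent (polyMul p (prodSeries ![a, b] w))

/-- The coefficient of `x₀ ^ j x ^ k` in
`ι_{x,x₀}(p(x₀ + αx, x)⁻¹) (p(x₁, x) a(x₁) b(x) w)|_{x₁ = αx + x₀}`. The sum, the convolution
in `ℂ((x))((x₀))` and `W((x))((x₀))`, is finite when `p` regularizes `(a, b)`. -/
def fieldYWith (p : MvPolynomial (Fin 2) ℂ) (α : ℂˣ) (a b : FieldSpace W)
    (w : W) (j k : ℤ) : W :=
  ∑ᶠ s : ℤ × ℤ, ((iotaInv α p).coeff s.1).coeff s.2 •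
    substScaled α (polyMul p (prodSeries ![a, b] w)) (j - s.1) (k - s.2)

open Classical in
/-- The operation `a(x)_{(α,n)} b(x)`, as an element of `Hom(W, W[[x, x⁻¹]])`: the coefficient of
`x₀ ^ (-n-1)` in `Y_𝓔^{(α)}(a(x), x₀) b(x)`. It is computed with a chosen polynomial
regularizing `(a, b)`, the result not depending on the choice; the operation is partial, and the
value for a pair that is not quasi compatible is irrelevant. -/
def modeProd (α : ℂˣ) (n : ℤ) (a b : FieldSpace W) : W → ℤ → W :=
  if h : ∃ p, Regularizes p a b then fun w k => fieldYWith h.choose α a b w (-n - 1) k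
  else 0

/-- `U` is closed: `a(x)_n b(x) = a(x)_{(1,n)} b(x)` is in `U` for `a(x), b(x) ∈ U`, `n ∈ ℤ`. -/
def ClosedUnderModes (U : Submodule ℂ (FieldSpace W)) : Prop :=
  ∀ a ∈ U, ∀ b ∈ U, ∀ n : ℤ, modeProd 1 n a b ∈ toSeries '' (U : Set (FieldSpace W))

end Compatible

/-- The coefficients of `Y(u, x₁) Y(v, x₂) w`. -/
def iterSeries {V : Type u} [AddCommGroup V] [Module ℂ V] {W : Type v} [AddCommGroup W]
    [Module ℂ W] (Y : V →ₗ[ℂ] FieldSpace W) (u v : V) (w : W) : (Fin 2 → ℤ) → W :=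
  prodSeries ![Y u, Y v] w

/-- The coefficients of `Y_W(Y(u, x₀) v, x₂) w`, in the variables `x₀, x₂`. -/
def nestedSeries {V : Type u} [AddCommGroup V] [Module ℂ V] {W : Type v} [AddCommGroup W]
    [Module ℂ W] (Y : V →ₗ[ℂ] FieldSpace V) (YW : V →ₗ[ℂ] FieldSpace W) (u v : V) (w : W) :
    (Fin 2 → ℤ) → W :=
  fun m => (YW ((Y u v).coeff (m 0)) w).coeff (m 1)

/-- The structure of a nonlocal vertex algebra on the vector space `V`. -/
structure NonlocalVertexAlgebra (V : Type u) [AddCommGroup V] [Module ℂ V] where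
  /-- `Y(·, x) : V → Hom(V, V((x)))` -/
  Y : V →ₗ[ℂ] FieldSpace V
  one : V
  one_Y : ∀ v, Y one v = HahnSeries.single 0 v
  creation_regular : ∀ v, ∀ n : ℤ, n < 0 → (Y v one).coeff n = 0
  creation_limit : ∀ v, (Y v one).coeff 0 = v
  /-- `(x₀ + x₂)^l Y(u, x₀ + x₂) Y(v, x₂) w = (x₀ + x₂)^l Y(Y(u, x₀) v, x₂) w` -/
  weak_assoc : ∀ u v w, ∃ l : ℕ,
    polyMul ((MvPolynomial.X 0 + MvPolynomial.X 1) ^ l) (substAdd (iterSeries Y u v w)) =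
      polyMul ((MvPolynomial.X 0 + MvPolynomial.X 1) ^ l) (nestedSeries Y Y u v w)

/-- The structure of a quasi `V`-module on the vector space `W`. -/
structure QuasiModule {V : Type u} [AddCommGroup V] [Module ℂ V] (A : NonlocalVertexAlgebra V)
    (W : Type v) [AddCommGroup W] [Module ℂ W] where
  /-- `Y_W(·, x) : V → Hom(W, W((x)))` -/
  Y : V →ₗ[ℂ] FieldSpace W
  one_Y : Y A.one = idField W
  /-- `f(x₀ + x₂, x₂) Y_W(u, x₀ + x₂) Y_W(v, x₂) w = f(x₀ + x₂, x₂) Y_W(Y(u, x₀) v, x₂) w` -/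
  quasi_assoc : ∀ u v w, ∃ f : MvPolynomial (Fin 2) ℂ, f ≠ 0 ∧
    polyMul (MvPolynomial.aeval ![MvPolynomial.X 0 + MvPolynomial.X 1, MvPolynomial.X 1] f)
        (substAdd (iterSeries Y u v w)) =
      polyMul (MvPolynomial.aeval ![MvPolynomial.X 0 + MvPolynomial.X 1, MvPolynomial.X 1] f)
        (nestedSeries A.Y Y u v w)

/-- A quasi module is faithful if `v ↦ Y_W(v, x)` is injective. -/
def QuasiModule.Faithful {V : Type u} [AddCommGroup V] [Module ℂ V]
    {A : NonlocalVertexAlgebra V} {W : Type v} [AddCommGroup W] [Module ℂ W]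
    (M : QuasiModule A W) : Prop :=
  Function.Injective M.Y

end NonlocalVA

end

set_option linter.unusedSectionVars false
set_option linter.unusedVariables false

/-! The expansion defining `Y_𝓔^{(α)}` is used through a characterization. A nonzero polynomial acts
injectively on `U((x))((x₀))`, by comparison of leading terms (`LexB.eq_zero_of_act`). Hence `H =
Y_𝓔^{(α)}(a(x), x₀)b(x)w` is the only series in `W((x))((x₀))` such that `p(αx + x₀, x) H` is the
honest substitution of `x₁ = αx + x₀` into `p(x₁, x)a(x₁)b(x)w`. Independence of `p`, bilinearity
and the axioms for `1_W` all follow from this uniqueness (`IsT2.unique`).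

Membership in `V` rests on `LabelledQC.mode`: in a quasi compatible sequence, adjacent entries `a,
b` may be replaced by any mode `a_{(α,n)}b`. After the variable of `a` is replaced by `αx_t + x₀`,
the regularizing polynomial is a polynomial in `x₀` over the other variables. Since the modes start
at a fixed power of `x₀`, each mode is regularized by a power of its trailing coefficient
(`laur_trailingCoeff_pow`). Trailing coefficients are multiplicative, so a product of polynomials in
pairs of variables yields another such product. The fields that can stand in for arbitrary sequences
from `V` (`Adjoinable`) form a quasi compatible subspace containing `V` and `1_W` and stable under
these modes; by maximality it equals `V`. Rescaling is the constant term of `Y_𝓔^{(α)}(a(x),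
x₀)1_W`.

For weak associativity, regularize `a(x₁)b(x₂)c(x₃)w` by `∏_{i<j} f(x_i, x_j)` and substitute in the
two possible orders (`act_assoc`). With `f(x + x₀, x) = x₀^k g(x₀, x)` and `g(0, x) ≠ 0`, the
substituted product is `x₀^k x₁^k (x₀ + x₁)^k u`, where `u` has a term free of `x₀, x₁`. The
monomials are invertible and `u` can be cancelled although the two sides lie in different iterated
Laurent spaces (`LexC.cancel`); only `(x₀ + x₁)^k` remains, with `k` independent of `w`. For the
quasi module `W`, a power of `x₁` is put into the polynomial to remove negative powers, after which
both expansions of the substitution coincide (`substAdd_eq_sub2`). -/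

noncomputable section

namespace NonlocalVA

open MvPolynomial

/-! ### Polynomials acting on formal series, and cancellation by leading terms. -/

section Action

variable {σ : Type*} {U U' : Type*} [AddCommGroup U] [Module ℂ U] [AddCommGroup U'] [Module ℂ U']

/-- An exponent of a monomial as an integral vector. -/
def expo (d : σ →₀ ℕ) : σ → ℤ := fun i => (d i : ℤ)

@[simp] lemma expo_apply (d : σ →₀ ℕ) (i : σ) : expo d i = (d i : ℤ) := rfl

lemma expo_zero : expo (0 : σ →₀ ℕ) = 0 := by ext; simp

lemma expo_add (d e : σ →₀ ℕ) : expo (d + e) = expo d + expo e := by ext; simp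

lemma expo_single [DecidableEq σ] (s : σ) : expo (Finsupp.single s 1) = Pi.single s 1 := by
  ext i
  by_cases h : i = s
  · subst h; simp
  · simp [h]

/-- The action of monomials on formal series. -/
def shift : Multiplicative (σ →₀ ℕ) →* Module.End ℂ ((σ → ℤ) → U) where
  toFun d :=
    { toFun := fun F m => F (m - expo d.toAdd)
      map_add' := fun _ _ => rfl
      map_smul' := fun _ _ => rfl }
  map_one' := by ext F m; simp [expo_zero]
  map_mul' d e := by
    ext F m
    simp only [toAdd_mul, expo_add, Module.End.mul_apply, LinearMap.coe_mk, AddHom.coe_mk]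
    congr 1; abel

/-- The action of polynomials on formal series. -/
def act : MvPolynomial σ ℂ →ₐ[ℂ] Module.End ℂ ((σ → ℤ) → U) :=
  AddMonoidAlgebra.lift ℂ _ _ shift

lemma act_apply (P : MvPolynomial σ ℂ) (F : (σ → ℤ) → U) (m : σ → ℤ) :
    act P F m = ∑ d ∈ P.support, P.coeff d • F (m - expo d) := by
  have : act (U := U) P = ∑ d ∈ P.support, P.coeff d • shift (Multiplicative.ofAdd d) :=
    AddMonoidAlgebra.lift_apply _ _
  rw [this]
  simp [shift]

lemma polyMul_eq_act {r : ℕ} (P : MvPolynomial (Fin r) ℂ) (F : (Fin r → ℤ) → U) :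
    polyMul P F = act P F := by
  ext m
  rw [act_apply]
  rfl

lemma act_monomial (d : σ →₀ ℕ) (c : ℂ) (F : (σ → ℤ) → U) (m : σ → ℤ) :
    act (monomial d c) F m = c • F (m - expo d) := by
  have : act (U := U) (monomial d c) = c • shift (Multiplicative.ofAdd d) :=
    AddMonoidAlgebra.lift_single _ _ _
  rw [this]
  simp [shift]

lemma act_X [DecidableEq σ] (s : σ) (F : (σ → ℤ) → U) (m : σ → ℤ) :
    act (X s) F m = F (m - Pi.single s 1) := by
  rw [X, act_monomial, expo_single, one_smul]

lemma act_C (c : ℂ) (F : (σ → ℤ) → U) : act (C c) F = c • F := by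
  ext m
  rw [C_apply, act_monomial, expo_zero, sub_zero, Pi.smul_apply]

lemma act_mul (P Q : MvPolynomial σ ℂ) (F : (σ → ℤ) → U) : act (P * Q) F = act P (act Q F) := by
  rw [map_mul, Module.End.mul_apply]

lemma act_comm (P Q : MvPolynomial σ ℂ) (F : (σ → ℤ) → U) :
    act P (act Q F) = act Q (act P F) := by
  rw [← act_mul, mul_comm, act_mul]

lemma act_add (P Q : MvPolynomial σ ℂ) (F : (σ → ℤ) → U) : act (P + Q) F = act P F + act Q F := by
  rw [map_add, LinearMap.add_apply]

lemma act_one (F : (σ → ℤ) → U) : act 1 F = F := by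
  rw [map_one, Module.End.one_apply]

/-- Applying a linear map to the coefficients commutes with the action of polynomials. -/
lemma act_comp (g : U →ₗ[ℂ] U') (P : MvPolynomial σ ℂ) (F : (σ → ℤ) → U) :
    act P (fun m => g (F m)) = fun m => g (act P F m) := by
  ext m
  simp [act_apply]

lemma exists_act_ne_zero {P : MvPolynomial σ ℂ} {F : (σ → ℤ) → U} {m : σ → ℤ}
    (h : act P F m ≠ 0) : ∃ d ∈ P.support, F (m - expo d) ≠ 0 := by
  by_contra! hc
  refine h ?_
  rw [act_apply]
  exact Finset.sum_eq_zero fun d hd => by rw [hc d hd, smul_zero]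

/-- Series in `U((x_i : i ∈ σ))`. -/
def Laur (F : (σ → ℤ) → U) : Prop := ∃ N : ℤ, ∀ m : σ → ℤ, F m ≠ 0 → ∀ i, N ≤ m i

lemma Laur.act {F : (σ → ℤ) → U} (hF : Laur F) (P : MvPolynomial σ ℂ) : Laur (act P F) := by
  obtain ⟨N, hN⟩ := hF
  refine ⟨N, fun m hm i => ?_⟩
  obtain ⟨d, -, hd⟩ := exists_act_ne_zero hm
  have := hN _ hd i
  simp at this
  omega

lemma Laur.add {F G : (σ → ℤ) → U} (hF : Laur F) (hG : Laur G) : Laur (F + G) := by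
  obtain ⟨N, hN⟩ := hF
  obtain ⟨M, hM⟩ := hG
  refine ⟨min N M, fun m hm i => ?_⟩
  by_cases h : F m = 0
  · have : G m ≠ 0 := by simpa [h] using hm
    exact (min_le_right _ _).trans (hM m this i)
  · exact (min_le_left _ _).trans (hN m h i)

lemma Laur.zero : Laur (0 : (σ → ℤ) → U) := ⟨0, fun m hm => absurd rfl hm⟩

lemma Laur.smul {F : (σ → ℤ) → U} (hF : Laur F) (c : ℂ) : Laur (c • F) := by
  rw [← act_C]; exact hF.act _

lemma Laur.comp {F : (σ → ℤ) → U} (hF : Laur F) (g : U →ₗ[ℂ] U') : Laur (fun m => g (F m)) := by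
  obtain ⟨N, hN⟩ := hF
  exact ⟨N, fun m hm => hN m fun h => hm (by simp [h])⟩

/-- Cancellation of a polynomial whose leading exponent (the least one, for an ordering of the
exponents) is `d`, on a set of exponents on which the support of the series is well ordered. -/
lemma act_cancel {Γ : Type*} [AddCommGroup Γ] [LinearOrder Γ] [IsOrderedAddMonoid Γ]
    (φ : (σ → ℤ) →+ Γ) (hφ : Function.Injective φ) {P : MvPolynomial σ ℂ} {F : (σ → ℤ) → U}
    {Z : Set (σ → ℤ)}
    (hwf : ∀ T : Set (σ → ℤ), T ⊆ Z → (∀ m ∈ T, F m ≠ 0) → T.Nonempty →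
      ∃ m ∈ T, ∀ m' ∈ T, φ m ≤ φ m')
    {d : σ →₀ ℕ} (hd : d ∈ P.support) (hmin : ∀ e ∈ P.support, φ (expo d) ≤ φ (expo e))
    (hZ : ∀ m ∈ Z, ∀ e ∈ P.support, m + expo d - expo e ∈ Z)
    (hPF : ∀ m ∈ Z, act P F (m + expo d) = 0) : ∀ m ∈ Z, F m = 0 := by
  by_contra! hne
  obtain ⟨m₀, hm₀, hF₀⟩ := hne
  obtain ⟨m, ⟨hmZ, hFm⟩, hm⟩ := hwf {m | m ∈ Z ∧ F m ≠ 0} (fun _ h => h.1) (fun _ h => h.2)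
    ⟨m₀, hm₀, hF₀⟩
  have h := hPF m hmZ
  -- In the coefficient of `P F` at `m + expo d` only `d` survives: another exponent `e` would give
  -- a point of the support of `F` in `Z` strictly below the minimal `m`.
  rw [act_apply, Finset.sum_eq_single d] at h
  · rw [add_sub_cancel_right] at h
    exact (smul_ne_zero (by simpa using hd) hFm) h
  · intro e he hed
    by_contra hc
    have hFe : F (m + expo d - expo e) ≠ 0 := fun h => hc (by rw [h, smul_zero])
    have h1 := hm _ ⟨hZ m hmZ e he, hFe⟩
    have h2 := hmin e he
    rw [map_sub, map_add] at h1
    have h3 : φ (expo d) = φ (expo e) := by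
      apply le_antisymm h2
      have := add_le_add_left h1 (φ (expo e))
      simpa using this
    apply hed
    have h4 := hφ h3
    ext i
    have := congrFun h4 i
    simpa using this.symm
  · exact fun h => absurd hd h

lemma exists_forall_le_of_bddBelow {α : Type*} {T : Set α} (f : α → ℤ) (hT : T.Nonempty)
    (hb : ∃ N, ∀ m ∈ T, N ≤ f m) : ∃ m ∈ T, ∀ m' ∈ T, f m ≤ f m' := by
  obtain ⟨N, hN⟩ := hb
  obtain ⟨t, ht⟩ := hT
  obtain ⟨l, ⟨m, hm, rfl⟩, hl⟩ := Int.exists_least_of_bdd (P := fun z => ∃ m ∈ T, f m = z)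
    ⟨N, by rintro z ⟨m, hm, rfl⟩; exact hN m hm⟩ ⟨_, t, ht, rfl⟩
  exact ⟨m, hm, fun m' hm' => hl _ ⟨m', hm', rfl⟩⟩

/-- The lexicographic ordering of the exponents by `f` and `g`. -/
def lexHom {G : Type*} [AddCommGroup G] {Γ : Type*} [AddCommGroup Γ]
    [LinearOrder Γ] [IsOrderedAddMonoid Γ] (f : G →+ ℤ) (g : G →+ Γ) : G →+ ℤ ×ₗ Γ where
  toFun m := toLex (f m, g m)
  map_zero' := by rw [map_zero, map_zero]; rfl
  map_add' m n := by rw [map_add, map_add]; rfl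

lemma lexHom_le {G : Type*} [AddCommGroup G] {Γ : Type*} [AddCommGroup Γ]
    [LinearOrder Γ] [IsOrderedAddMonoid Γ] {f : G →+ ℤ} {g : G →+ Γ} {m n : G} :
    lexHom f g m ≤ lexHom f g n ↔ f m < f n ∨ f m = f n ∧ g m ≤ g n :=
  Prod.Lex.toLex_le_toLex

lemma lexHom_injective {G : Type*} [AddCommGroup G] {Γ : Type*} [AddCommGroup Γ]
    [LinearOrder Γ] [IsOrderedAddMonoid Γ] {f : G →+ ℤ} {g : G →+ Γ}
    (h : ∀ m, f m = 0 → g m = 0 → m = 0) : Function.Injective (lexHom f g) := by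
  rw [injective_iff_map_eq_zero]
  intro m hm
  have hm' : toLex (f m, g m) = toLex (0, 0) := hm
  have h2 := toLex.injective hm'
  simp only [Prod.mk.injEq] at h2
  exact h m h2.1 h2.2

end Action

/-! ### Iterated Laurent series in two variables. -/

section Two

variable {U U' : Type*} [AddCommGroup U] [Module ℂ U] [AddCommGroup U'] [Module ℂ U']

/-- Series in `U((x₁))((x₀))`, in the variables `x₀, x₁`. -/
def LexB (H : (Fin 2 → ℤ) → U) : Prop :=
  (∃ N : ℤ, ∀ m, H m ≠ 0 → N ≤ m 0) ∧ ∀ j : ℤ, ∃ N : ℤ, ∀ m, H m ≠ 0 → m 0 = j → N ≤ m 1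

lemma LexB.add {F G : (Fin 2 → ℤ) → U} (hF : LexB F) (hG : LexB G) : LexB (F + G) := by
  obtain ⟨⟨N, hN⟩, hF⟩ := hF
  obtain ⟨⟨M, hM⟩, hG⟩ := hG
  refine ⟨⟨min N M, fun m hm => ?_⟩, fun j => ?_⟩
  · by_cases h : F m = 0
    · have : G m ≠ 0 := by simpa [h] using hm
      exact (min_le_right _ _).trans (hM m this)
    · exact (min_le_left _ _).trans (hN m h)
  · obtain ⟨A, hA⟩ := hF j
    obtain ⟨B, hB⟩ := hG j
    refine ⟨min A B, fun m hm hj => ?_⟩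
    by_cases h : F m = 0
    · have : G m ≠ 0 := by simpa [h] using hm
      exact (min_le_right _ _).trans (hB m this hj)
    · exact (min_le_left _ _).trans (hA m h hj)

lemma LexB.zero : LexB (0 : (Fin 2 → ℤ) → U) :=
  ⟨⟨0, fun m hm => absurd rfl hm⟩, fun _ => ⟨0, fun m hm => absurd rfl hm⟩⟩

lemma LexB.monomial {F : (Fin 2 → ℤ) → U} (hF : LexB F) (d : Fin 2 →₀ ℕ) (c : ℂ) :
    LexB (act (monomial d c) F) := by
  obtain ⟨⟨N, hN⟩, hF⟩ := hF
  refine ⟨⟨N, fun m hm => ?_⟩, fun j => ?_⟩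
  · rw [act_monomial] at hm
    have := hN _ (right_ne_zero_of_smul hm)
    simp at this; omega
  · obtain ⟨A, hA⟩ := hF (j - d 0)
    refine ⟨A, fun m hm hj => ?_⟩
    rw [act_monomial] at hm
    have := hA _ (right_ne_zero_of_smul hm) (by simp [hj])
    simp at this; omega

lemma LexB.act {F : (Fin 2 → ℤ) → U} (hF : LexB F) (P : MvPolynomial (Fin 2) ℂ) :
    LexB (act P F) := by
  induction P using MvPolynomial.induction_on' with
  | monomial d c => exact hF.monomial d c
  | add P Q hP hQ => rw [act_add]; exact hP.add hQ

lemma LexB.smul {F : (Fin 2 → ℤ) → U} (hF : LexB F) (c : ℂ) : LexB (c • F) := by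
  rw [← act_C]; exact hF.act _

lemma LexB.comp {F : (Fin 2 → ℤ) → U} (hF : LexB F) (g : U →ₗ[ℂ] U') :
    LexB (fun m => g (F m)) :=
  have h : ∀ m, g (F m) ≠ 0 → F m ≠ 0 := fun m hm h => hm (by simp [h])
  ⟨hF.1.imp fun _ hN m hm => hN m (h m hm), fun j => (hF.2 j).imp fun _ hN m hm => hN m (h m hm)⟩

/-- The ordering of the exponents of `x₀, x₁` for which series in `U((x₁))((x₀))` have leading
terms. -/
def lexTwo : (Fin 2 → ℤ) →+ ℤ ×ₗ ℤ := lexHom (Pi.evalAddMonoidHom _ 0) (Pi.evalAddMonoidHom _ 1)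

lemma lexTwo_le {m n : Fin 2 → ℤ} : lexTwo m ≤ lexTwo n ↔ m 0 < n 0 ∨ m 0 = n 0 ∧ m 1 ≤ n 1 :=
  lexHom_le

lemma lexTwo_injective : Function.Injective lexTwo :=
  lexHom_injective fun m h0 h1 => by
    ext i
    fin_cases i
    · exact h0
    · exact h1

lemma LexB.exists_min {F : (Fin 2 → ℤ) → U} (hF : LexB F) (T : Set (Fin 2 → ℤ))
    (hT : ∀ m ∈ T, F m ≠ 0) (hne : T.Nonempty) : ∃ m ∈ T, ∀ m' ∈ T, lexTwo m ≤ lexTwo m' := by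
  obtain ⟨⟨N, hN⟩, hF⟩ := hF
  obtain ⟨a, ha, ha'⟩ := exists_forall_le_of_bddBelow (fun m : Fin 2 → ℤ => m 0) hne
    ⟨N, fun m hm => hN m (hT m hm)⟩
  obtain ⟨A, hA⟩ := hF (a 0)
  obtain ⟨b, ⟨hb, hb0⟩, hb'⟩ := exists_forall_le_of_bddBelow (T := {m | m ∈ T ∧ m 0 = a 0})
    (fun m : Fin 2 → ℤ => m 1) ⟨a, ha, rfl⟩ ⟨A, fun m hm => hA m (hT m hm.1) hm.2⟩
  refine ⟨b, hb, fun m hm => ?_⟩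
  rw [lexTwo_le]
  rcases lt_or_eq_of_le (ha' m hm) with h | h
  · left; rw [hb0]; exact h
  · right; exact ⟨hb0.trans h, hb' m ⟨hm, h.symm⟩⟩

lemma exists_lead {σ : Type*} {Γ : Type*} [LinearOrder Γ] (φ : (σ → ℤ) → Γ)
    {P : MvPolynomial σ ℂ} (hP : P ≠ 0) :
    ∃ d ∈ P.support, ∀ e ∈ P.support, φ (expo d) ≤ φ (expo e) :=
  Finset.exists_min_image _ _ (support_nonempty.2 hP)

lemma LexB.eq_zero_of_act {F : (Fin 2 → ℤ) → U} (hF : LexB F) {P : MvPolynomial (Fin 2) ℂ}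
    (hP : P ≠ 0) (h : NonlocalVA.act P F = 0) : F = 0 := by
  obtain ⟨d, hd, hmin⟩ := exists_lead lexTwo hP
  ext m
  exact act_cancel (Z := Set.univ) lexTwo lexTwo_injective (fun T _ hT => hF.exists_min T hT) hd hmin
    (fun _ _ _ _ => trivial) (fun m _ => by rw [h]; rfl) m trivial

lemma LexB.eq_of_act {F G : (Fin 2 → ℤ) → U} (hF : LexB F) (hG : LexB G)
    {P : MvPolynomial (Fin 2) ℂ} (hP : P ≠ 0)
    (h : NonlocalVA.act P F = NonlocalVA.act P G) : F = G := by
  have h2 : F + (-1 : ℂ) • G = 0 :=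
    (hF.add (hG.smul _)).eq_zero_of_act hP (by rw [map_add, map_smul, h]; simp)
  simpa [← sub_eq_add_neg, sub_eq_zero] using h2

/-- If `P F` has no negative powers of `x₀`, the powers of `x₀` in `F` are bounded below in terms
of `P`. -/
lemma exists_bound_of_act {P : MvPolynomial (Fin 2) ℂ} (hP : P ≠ 0) :
    ∃ N : ℤ, ∀ (U : Type*) [AddCommGroup U] [Module ℂ U] (F : (Fin 2 → ℤ) → U), LexB F →
      (∀ m, m 0 < 0 → act P F m = 0) → ∀ m, m 0 < N → F m = 0 := by
  obtain ⟨d, hd, hmin⟩ := exists_lead lexTwo hP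
  -- The leading exponent has the least power of `x₀` in `P`, so the bound depends on `P` alone;
  -- this later makes the truncation of modes uniform in `w`.
  refine ⟨- d 0, fun U _ _ F hF h => ?_⟩
  have hd0 : ∀ e ∈ P.support, d 0 ≤ e 0 := fun e he => by
    have := lexTwo_le.1 (hmin e he)
    simp at this
    omega
  refine act_cancel (Z := {m | m 0 < - d 0}) lexTwo lexTwo_injective
    (fun T _ hT => hF.exists_min T hT) hd hmin (fun m hm e he => ?_) (fun m hm => h _ ?_)
  · have := hd0 e he
    simp at hm ⊢
    omega
  · simp at hm ⊢
    omega

end Two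

/-! ### The substitution `x_s ↦ c x_t + x_s` on polynomials. -/

section Tau

variable {σ : Type*} [DecidableEq σ]

/-- The substitution `x_s ↦ c x_t + x_s`. -/
def tau (c : ℂ) (s t : σ) : MvPolynomial σ ℂ →ₐ[ℂ] MvPolynomial σ ℂ :=
  aeval (Function.update X s (C c * X t + X s))

@[simp] lemma tau_X_self (c : ℂ) (s t : σ) : tau c s t (X s) = C c * X t + X s := by
  simp [tau]

lemma tau_X_of_ne (c : ℂ) {s t u : σ} (h : u ≠ s) : tau c s t (X u) = X u := by
  simp [tau, h]

@[simp] lemma tau_C (c : ℂ) (s t : σ) (a : ℂ) : tau c s t (C a) = C a := by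
  rw [MvPolynomial.algHom_C, MvPolynomial.algebraMap_eq]

lemma tau_neg_tau (c : ℂ) {s t : σ} (h : t ≠ s) (P : MvPolynomial σ ℂ) :
    tau (-c) s t (tau c s t P) = P := by
  have : (tau (-c) s t).comp (tau c s t) = AlgHom.id ℂ _ := by
    ext u : 1
    by_cases hu : u = s
    · subst hu
      simp [tau_X_of_ne _ h]
    · simp [tau_X_of_ne _ hu]
  exact DFunLike.congr_fun this P

lemma tau_ne_zero (c : ℂ) {s t : σ} (h : t ≠ s) {P : MvPolynomial σ ℂ} (hP : P ≠ 0) :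
    tau c s t P ≠ 0 := fun h0 => hP (by rw [← tau_neg_tau c h P, h0, map_zero])

end Tau

lemma exists_of_finsum_ne_zero {ι M : Type*} [AddCommMonoid M] {f : ι → M}
    (h : ∑ᶠ i, f i ≠ 0) : ∃ i, f i ≠ 0 := by
  by_contra! hc
  exact h ((finsum_congr hc).trans finsum_zero)

/-! ### Substituting `αx + x₀` into series, and its characterization. -/

section Sub

variable {U U' : Type*} [AddCommGroup U] [Module ℂ U] [AddCommGroup U'] [Module ℂ U']

/-- The coefficients of `F(αx + x₀, x)`. -/
def sub2 (α : ℂˣ) (F : (Fin 2 → ℤ) → U) : (Fin 2 → ℤ) → U :=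
  fun m => substScaled α F (m 0) (m 1)

/-- The coefficient of `F_{i, k - (i - j)}` in `F(αx + x₀, x)` at `x₀ ^ j x ^ k`. -/
def subCoeff (α : ℂˣ) (j i : ℤ) : ℂ :=
  if 0 ≤ j then ((Ring.choose i j.toNat : ℤ) : ℂ) * (α : ℂ) ^ (i - j) else 0

lemma sub2_apply (α : ℂˣ) (F : (Fin 2 → ℤ) → U) (m : Fin 2 → ℤ) :
    sub2 α F m = ∑ᶠ i : ℤ, subCoeff α (m 0) i • F ![i, m 1 - (i - m 0)] := by
  unfold sub2 substScaled subCoeff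
  split_ifs with h
  · rfl
  · simp

lemma Laur.finite_sub {F : (Fin 2 → ℤ) → U} (hF : Laur F) (f : ℤ → ℂ) (m : Fin 2 → ℤ) :
    (Function.support fun i : ℤ => f i • F ![i, m 1 - (i - m 0)]).Finite := by
  obtain ⟨N, hN⟩ := hF
  refine (Set.finite_Icc N (m 1 + m 0 - N)).subset fun i hi => ?_
  have h := hN _ (right_ne_zero_of_smul hi)
  have h0 := h 0
  have h1 := h 1
  simp at h0 h1
  constructor <;> omega

lemma sub2_add (α : ℂˣ) {F G : (Fin 2 → ℤ) → U} (hF : Laur F) (hG : Laur G) :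
    sub2 α (F + G) = sub2 α F + sub2 α G := by
  ext m
  simp only [sub2_apply, Pi.add_apply, smul_add]
  exact finsum_add_distrib (hF.finite_sub _ m) (hG.finite_sub _ m)

lemma sub2_smul (α : ℂˣ) (c : ℂ) (F : (Fin 2 → ℤ) → U) :
    sub2 α (c • F) = c • sub2 α F := by
  ext m
  simp only [sub2_apply, Pi.smul_apply, smul_finsum]
  exact finsum_congr fun i => smul_comm _ _ _

lemma sub2_comp (α : ℂˣ) {F : (Fin 2 → ℤ) → U} (hF : Laur F) (g : U →ₗ[ℂ] U') :
    sub2 α (fun m => g (F m)) = fun m => g (sub2 α F m) := by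
  ext m
  simp only [sub2_apply]
  exact ((g.toAddMonoidHom.map_finsum (hF.finite_sub _ m)).trans
    (finsum_congr fun i => map_smul g _ _)).symm

lemma sub2_X_one (α : ℂˣ) (F : (Fin 2 → ℤ) → U) :
    sub2 α (act (X 1) F) = act (X 1) (sub2 α F) := by
  ext m
  simp only [sub2_apply, act_X]
  refine finsum_congr fun i => ?_
  have : (![i, m 1 - (i - m 0)] : Fin 2 → ℤ) - Pi.single 1 1 =
      ![i, (m - Pi.single 1 1 : Fin 2 → ℤ) 1 - (i - (m - Pi.single 1 1 : Fin 2 → ℤ) 0)] := by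
    ext u
    fin_cases u <;> simp
    ring
  rw [this]
  simp

/-- Pascal's rule: compare coefficients in `(αx + x₀)^(i+1) = (αx + x₀)(αx + x₀)^i`. -/
lemma subCoeff_succ (α : ℂˣ) (j i : ℤ) :
    subCoeff α j (i + 1) = α * subCoeff α j i + subCoeff α (j - 1) i := by
  unfold subCoeff
  have hα : (α : ℂ) ≠ 0 := α.ne_zero
  rcases lt_trichotomy j 0 with h | rfl | h
  · rw [if_neg (by omega), if_neg (by omega), if_neg (by omega)]; simp
  · simp only [le_refl, if_true]
    rw [if_neg (by omega)]
    simp only [Int.toNat_zero, Ring.choose_zero_right, sub_zero, zpow_add_one₀ hα]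
    push_cast; ring
  · rw [if_pos h.le, if_pos h.le, if_pos (by omega)]
    obtain ⟨k, rfl⟩ : ∃ k : ℕ, j = k + 1 := ⟨(j - 1).toNat, by omega⟩
    have h1 : ((k : ℤ) + 1).toNat = k + 1 := by omega
    have h2 : ((k : ℤ) + 1 - 1).toNat = k := by omega
    rw [h1, h2, Ring.choose_succ_succ]
    have h3 : i + 1 - ((k : ℤ) + 1) = (i - (k + 1)) + 1 := by ring
    have h4 : i - ((k : ℤ) + 1 - 1) = (i - (k + 1)) + 1 := by ring
    rw [h3, h4, zpow_add_one₀ hα]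
    push_cast
    ring

lemma sub2_X_zero (α : ℂˣ) {F : (Fin 2 → ℤ) → U} (hF : Laur F) :
    sub2 α (act (X 0) F) = act (C (α : ℂ) * X 1 + X 0) (sub2 α F) := by
  ext m
  have h1 : sub2 α (act (X 0) F) m =
      ∑ᶠ i : ℤ, subCoeff α (m 0) (i + 1) • F ![i, m 1 - (i + 1 - m 0)] := by
    rw [sub2_apply, ← finsum_comp_equiv (Equiv.addRight (1 : ℤ))]
    refine finsum_congr fun i => ?_
    rw [act_X]
    congr 2
    ext u
    fin_cases u <;> simp
  have h2 : act (C (α : ℂ) * X 1 + X 0) (sub2 α F) m =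
      (∑ᶠ i : ℤ, ((α : ℂ) * subCoeff α (m 0) i) • F ![i, m 1 - (i + 1 - m 0)]) +
        ∑ᶠ i : ℤ, subCoeff α (m 0 - 1) i • F ![i, m 1 - (i + 1 - m 0)] := by
    rw [act_add, act_mul, act_C, Pi.add_apply, Pi.smul_apply, act_X, act_X, sub2_apply,
      sub2_apply, smul_finsum]
    congr 1
    · refine finsum_congr fun i => ?_
      rw [smul_smul]
      congr 2
      · simp
      · ext u
        fin_cases u <;> simp
        ring
    · refine finsum_congr fun i => ?_
      have : i - ((m - Pi.single 0 1 : Fin 2 → ℤ) 0) = i + 1 - m 0 := by simp; ring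
      rw [this]
      simp
  have hfin : ∀ f : ℤ → ℂ,
      (Function.support fun i : ℤ => f i • F ![i, m 1 - (i + 1 - m 0)]).Finite := fun f => by
    have := hF.finite_sub f (m - Pi.single 1 1)
    refine this.subset fun i hi => ?_
    have e : (![i, (m - Pi.single 1 1 : Fin 2 → ℤ) 1 - (i - (m - Pi.single 1 1 : Fin 2 → ℤ) 0)] :
        Fin 2 → ℤ) = ![i, m 1 - (i + 1 - m 0)] := by
      ext u
      fin_cases u <;> simp
      ring
    rw [Function.mem_support, e]
    exact hi
  rw [h1, h2, ← finsum_add_distrib (hfin _) (hfin _)]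
  exact finsum_congr fun i => by rw [← add_smul, subCoeff_succ]

/-- It suffices to check the two variables, and `Laur` keeps every rearranged sum finite. This
multiplicativity is the only property of the substitution needed for the uniqueness in
`IsT2.unique`. -/
lemma sub2_act (α : ℂˣ) {F : (Fin 2 → ℤ) → U} (hF : Laur F) (P : MvPolynomial (Fin 2) ℂ) :
    sub2 α (act P F) = act (tau (α : ℂ) 0 1 P) (sub2 α F) := by
  induction P using MvPolynomial.induction_on generalizing F with
  | C a => rw [tau_C, act_C, act_C, sub2_smul]
  | add P Q hP hQ =>
    rw [act_add, sub2_add α (hF.act _) (hF.act _), hP hF, hQ hF, map_add, act_add]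
  | mul_X P s hP =>
    rw [act_mul, hP (hF.act _), map_mul, act_mul]
    congr 1
    fin_cases s
    · exact (sub2_X_zero α hF).trans (by simp)
    · exact (sub2_X_one α F).trans (by simp [tau_X_of_ne])

lemma sub2_of_neg (α : ℂˣ) (F : (Fin 2 → ℤ) → U) {m : Fin 2 → ℤ} (h : m 0 < 0) :
    sub2 α F m = 0 := by
  unfold sub2 substScaled
  rw [if_neg (by omega)]

lemma Laur.lexB_sub2 {F : (Fin 2 → ℤ) → U} (hF : Laur F) (α : ℂˣ) : LexB (sub2 α F) := by
  refine ⟨⟨0, fun m hm => ?_⟩, fun j => ?_⟩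
  · by_contra h
    exact hm (sub2_of_neg α F (by omega))
  · obtain ⟨N, hN⟩ := hF
    -- A nonzero term has `N ≤ i` and `N ≤ m 1 - (i - j)`; add the two.
    refine ⟨2 * N - j, fun m hm hj => ?_⟩
    rw [sub2_apply] at hm
    obtain ⟨i, hi⟩ := exists_of_finsum_ne_zero hm
    have h := hN _ (right_ne_zero_of_smul hi)
    have h0 := h 0
    have h1 := h 1
    simp at h0 h1
    omega

lemma Laur.lexB {F : (Fin 2 → ℤ) → U} (hF : Laur F) : LexB F :=
  ⟨hF.imp fun _ hN m hm => hN m hm 0, fun _ => hF.imp fun _ hN m hm _ => hN m hm 1⟩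

/-- `H(x₀, x)` is `G(αx + x₀, x)` for a series `G(x₁, x)` that belongs to `U((x₁, x))` after
multiplication by a nonzero polynomial. -/
def IsT2 (α : ℂˣ) (G H : (Fin 2 → ℤ) → U) : Prop :=
  ∃ q : MvPolynomial (Fin 2) ℂ, q ≠ 0 ∧ Laur (act q G) ∧ LexB H ∧
    act (tau (α : ℂ) 0 1 q) H = sub2 α (act q G)

/-- After multiplication by the image of `q * q'` both candidates become the substitution of the
same Laurent series, and that image is nonzero because `tau` is invertible. -/
lemma IsT2.unique {α : ℂˣ} {G H H' : (Fin 2 → ℤ) → U} (h : IsT2 α G H) (h' : IsT2 α G H') :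
    H = H' := by
  obtain ⟨q, hq, hG, hH, e⟩ := h
  obtain ⟨q', hq', hG', hH', e'⟩ := h'
  refine hH.eq_of_act hH' (tau_ne_zero (α : ℂ) (s := 0) (t := 1) (by decide) (mul_ne_zero hq hq')) ?_
  rw [map_mul, act_mul, act_comm, e, ← sub2_act α hG, act_mul, e', ← sub2_act α hG', act_comm]

lemma IsT2.lexB {α : ℂˣ} {G H : (Fin 2 → ℤ) → U} (h : IsT2 α G H) : LexB H := by
  obtain ⟨-, -, -, h, -⟩ := h
  exact h

lemma Laur.isT2 {G : (Fin 2 → ℤ) → U} (hG : Laur G) (α : ℂˣ) : IsT2 α G (sub2 α G) :=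
  ⟨1, one_ne_zero, by rwa [act_one], hG.lexB_sub2 α, by rw [map_one, act_one, act_one]⟩

lemma IsT2.act {α : ℂˣ} {G H : (Fin 2 → ℤ) → U} (h : IsT2 α G H) (P : MvPolynomial (Fin 2) ℂ) :
    IsT2 α (act P G) (act (tau (α : ℂ) 0 1 P) H) := by
  obtain ⟨q, hq, hG, hH, e⟩ := h
  refine ⟨q, hq, ?_, hH.act _, ?_⟩
  · rw [act_comm]; exact hG.act _
  · rw [act_comm, e, act_comm q, sub2_act α hG]

lemma IsT2.add {α : ℂˣ} {G H G' H' : (Fin 2 → ℤ) → U} (h : IsT2 α G H) (h' : IsT2 α G' H') :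
    IsT2 α (G + G') (H + H') := by
  obtain ⟨q, hq, hG, hH, e⟩ := h
  obtain ⟨q', hq', hG', hH', e'⟩ := h'
  have h1 : Laur (NonlocalVA.act (q * q') G) := by rw [mul_comm, act_mul]; exact hG.act _
  have h2 : Laur (NonlocalVA.act (q * q') G') := by rw [act_mul]; exact hG'.act _
  refine ⟨q * q', mul_ne_zero hq hq', ?_, hH.add hH', ?_⟩
  · rw [map_add]; exact h1.add h2
  · rw [map_add, map_add, sub2_add α h1 h2]
    congr 1
    · rw [mul_comm q q', map_mul, act_mul, e, act_mul, sub2_act α hG]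
    · rw [map_mul, act_mul, e', act_mul, sub2_act α hG']

lemma IsT2.smul {α : ℂˣ} {G H : (Fin 2 → ℤ) → U} (h : IsT2 α G H) (c : ℂ) :
    IsT2 α (c • G) (c • H) := by
  have := h.act (C c)
  rwa [tau_C, act_C, act_C] at this

lemma IsT2.comp {α : ℂˣ} {G H : (Fin 2 → ℤ) → U} (h : IsT2 α G H) (g : U →ₗ[ℂ] U') :
    IsT2 α (fun m => g (G m)) (fun m => g (H m)) := by
  obtain ⟨q, hq, hG, hH, e⟩ := h
  refine ⟨q, hq, ?_, hH.comp g, ?_⟩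
  · rw [act_comp]; exact hG.comp g
  · rw [act_comp, act_comp, e, sub2_comp α hG]

end Sub

/-! ### The explicit expansion of `p(x₀ + αx, x)⁻¹` satisfies the characterization. -/

section Conv

variable {U : Type*} [AddCommGroup U] [Module ℂ U]

/-- The product of a scalar and a vector valued series in two variables. -/
def conv (κ : (Fin 2 → ℤ) → ℂ) (S : (Fin 2 → ℤ) → U) : (Fin 2 → ℤ) → U :=
  fun m => ∑ᶠ s : ℤ × ℤ, κ ![s.1, s.2] • S ![m 0 - s.1, m 1 - s.2]

lemma LexB.finite_conv {κ : (Fin 2 → ℤ) → ℂ} {S : (Fin 2 → ℤ) → U} (hκ : LexB κ) (hS : LexB S)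
    (m : Fin 2 → ℤ) :
    (Function.support fun s : ℤ × ℤ => κ ![s.1, s.2] • S ![m 0 - s.1, m 1 - s.2]).Finite := by
  obtain ⟨⟨N, hN⟩, hκ⟩ := hκ
  obtain ⟨⟨M, hM⟩, hS⟩ := hS
  choose A hA using hκ
  choose B hB using hS
  refine ((Set.finite_Icc N (m 0 - M)).biUnion (t := fun i =>
    ({i} : Set ℤ) ×ˢ Set.Icc (A i) (m 1 - B (m 0 - i)))
    fun i _ => (Set.finite_singleton _).prod (Set.finite_Icc _ _)).subset fun s hs => ?_
  have h1 := left_ne_zero_of_smul hs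
  have h2 := right_ne_zero_of_smul hs
  have a := hN _ h1
  have b := hM _ h2
  have c := hA s.1 _ h1 (by simp)
  have d := hB (m 0 - s.1) _ h2 (by simp)
  simp at a b c d
  simp only [Set.mem_iUnion, Set.mem_prod, Set.mem_Icc, Set.mem_singleton_iff]
  exact ⟨s.1, ⟨a, by omega⟩, rfl, c, by omega⟩

lemma LexB.conv {κ : (Fin 2 → ℤ) → ℂ} {S : (Fin 2 → ℤ) → U} (hκ : LexB κ) (hS : LexB S) :
    LexB (conv κ S) := by
  obtain ⟨⟨N, hN⟩, hκ⟩ := hκ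
  obtain ⟨⟨M, hM⟩, hS⟩ := hS
  choose A hA using hκ
  choose B hB using hS
  have key : ∀ m, NonlocalVA.conv κ S m ≠ 0 → ∃ i, N ≤ i ∧ M ≤ m 0 - i ∧ A i + B (m 0 - i) ≤ m 1 := by
    intro m hm
    obtain ⟨s, hs⟩ := exists_of_finsum_ne_zero hm
    have h1 := left_ne_zero_of_smul hs
    have h2 := right_ne_zero_of_smul hs
    have a := hN _ h1
    have b := hM _ h2
    have c := hA s.1 _ h1 (by simp)
    have d := hB (m 0 - s.1) _ h2 (by simp)
    simp at a b c d
    exact ⟨s.1, a, by omega, by omega⟩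
  refine ⟨⟨N + M, fun m hm => ?_⟩, fun j => ?_⟩
  · obtain ⟨i, h1, h2, -⟩ := key m hm
    omega
  · obtain ⟨K, hK⟩ := ((Finset.Icc N (j - M)).image fun i => A i + B (j - i)).bddBelow
    refine ⟨K, fun m hm hj => ?_⟩
    obtain ⟨i, h1, h2, h3⟩ := key m hm
    subst hj
    have h4 : A i + B (m 0 - i) ∈ (Finset.Icc N (m 0 - M)).image fun i => A i + B (m 0 - i) :=
      Finset.mem_image_of_mem _ (Finset.mem_Icc.2 ⟨h1, by omega⟩)
    exact (hK h4).trans h3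

lemma act_conv {κ : (Fin 2 → ℤ) → ℂ} {S : (Fin 2 → ℤ) → U} (hκ : LexB κ) (hS : LexB S)
    (P : MvPolynomial (Fin 2) ℂ) : act P (conv κ S) = conv (act P κ) S := by
  induction P using MvPolynomial.induction_on' with
  | add P Q hP hQ =>
    rw [act_add, hP, hQ, act_add]
    ext m
    refine (finsum_add_distrib ((hκ.act P).finite_conv hS m) ((hκ.act Q).finite_conv hS m)).symm.trans
      (finsum_congr fun s => (add_smul _ _ _).symm)
  | monomial d c =>
    ext m
    rw [act_monomial]
    unfold conv
    rw [smul_finsum]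
    conv_rhs => rw [← finsum_comp_equiv (Equiv.addRight ((d 0 : ℤ), (d 1 : ℤ)))]
    refine finsum_congr fun s => ?_
    rw [act_monomial, smul_eq_mul, mul_smul]
    congr 3
    · ext u; fin_cases u <;> simp
    · ext u; fin_cases u <;> simp <;> ring

lemma conv_single (S : (Fin 2 → ℤ) → U) {κ : (Fin 2 → ℤ) → ℂ} (h0 : κ 0 = 1)
    (h : ∀ m, m ≠ 0 → κ m = 0) : conv κ S = S := by
  ext m
  unfold conv
  rw [finsum_eq_single _ (0, 0)]
  · have : (![((0 : ℤ), (0 : ℤ)).1, ((0 : ℤ), (0 : ℤ)).2] : Fin 2 → ℤ) = 0 := by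
      ext u; fin_cases u <;> rfl
    rw [this, h0, one_smul]
    congr 1
    ext u; fin_cases u <;> simp
  · intro s hs
    rw [h, zero_smul]
    intro h0
    apply hs
    have a := congrFun h0 0
    have b := congrFun h0 1
    simp at a b
    exact Prod.ext a b

section Expansion

variable {K : Type*} [Field K] (c : ℂ →+* K) (x : K) (κ : K →+ ℤ → ℂ)

/-- The embedding of polynomials in `x₀, x` into `K((x₀))`, for an element `x` of `K`. -/
def toLaurent : MvPolynomial (Fin 2) ℂ →+* LaurentSeries K :=
  MvPolynomial.eval₂Hom ((HahnSeries.C : K →+* LaurentSeries K).comp c)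
    ![HahnSeries.single 1 1, HahnSeries.C x]

/-- The coefficients of a series in `K((x₀))`, if those of the elements of `K` are given by `κ`. -/
def lcoeff (f : LaurentSeries K) : (Fin 2 → ℤ) → ℂ := fun m => κ (f.coeff (m 0)) (m 1)

variable {c x κ}

/-- Translates products in the field `K((x₀))` into the shift action on coefficients, so that the
inverse in `invSubst` can be handled by `act`. -/
lemma lcoeff_mul (hc : ∀ a y, κ (c a * y) = a • κ y) (hx : ∀ y n, κ (x * y) n = κ y (n - 1))
    (P : MvPolynomial (Fin 2) ℂ) (f : LaurentSeries K) :
    lcoeff κ (toLaurent c x P * f) = act P (lcoeff κ f) := by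
  induction P using MvPolynomial.induction_on generalizing f with
  | C a =>
    rw [act_C]
    ext m
    simp [toLaurent, lcoeff, hc]
  | add P Q hP hQ =>
    rw [map_add, add_mul, act_add, ← hP, ← hQ]
    ext m
    simp [lcoeff]
  | mul_X P s hP =>
    rw [map_mul, mul_assoc, hP, act_mul]
    congr 1
    ext m
    rw [act_X]
    fin_cases s
    · have := HahnSeries.coeff_single_mul_add (r := (1 : K)) (x := f) (a := m 0 - 1) (b := 1)
      simp [toLaurent, lcoeff] at this ⊢
      rw [this]
    · simp [toLaurent, lcoeff, hx]

/-- If the image of `P` vanished, `P` would annihilate the coefficient series of `1`, contradicting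
cancellation for `LexB`. -/
lemma toLaurent_ne_zero (hc : ∀ a y, κ (c a * y) = a • κ y)
    (hx : ∀ y n, κ (x * y) n = κ y (n - 1)) (h1 : lcoeff κ 1 ≠ 0) (hl : LexB (lcoeff κ 1))
    {P : MvPolynomial (Fin 2) ℂ} (hP : P ≠ 0) : toLaurent c x P ≠ 0 := by
  intro h
  have h2 := lcoeff_mul hc hx P 1
  rw [h, zero_mul] at h2
  refine h1 (hl.eq_zero_of_act hP (h2.symm.trans ?_))
  ext m
  simp [lcoeff]

lemma act_lcoeff_invSubst (hc : ∀ a y, κ (c a * y) = a • κ y)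
    (hx : ∀ y n, κ (x * y) n = κ y (n - 1)) (h1 : lcoeff κ 1 ≠ 0) (hl : LexB (lcoeff κ 1))
    (α : ℂˣ) {p : MvPolynomial (Fin 2) ℂ} (hp : p ≠ 0) :
    act (tau (α : ℂ) 0 1 p) (lcoeff κ (invSubst c x α p)) = lcoeff κ 1 := by
  have h : invSubst c x α p = (toLaurent c x (tau (α : ℂ) 0 1 p))⁻¹ := by
    unfold invSubst
    congr 1
    change _ = ((toLaurent c x).comp (tau (α : ℂ) (0 : Fin 2) 1).toRingHom) p
    congr 1
    apply MvPolynomial.ringHom_ext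
    · intro a
      simp [toLaurent]
    · intro i
      fin_cases i
      · simp [toLaurent, add_comm]
      · simp [toLaurent, tau_X_of_ne]
  rw [← lcoeff_mul hc hx, h, mul_inv_cancel₀]
  exact toLaurent_ne_zero hc hx h1 hl (tau_ne_zero _ (by decide) hp)

end Expansion

/-- The coefficients of a Laurent series. -/
def coeffHom : LaurentSeries ℂ →+ ℤ → ℂ where
  toFun f := f.coeff
  map_zero' := rfl
  map_add' _ _ := rfl

/-- The coefficients of `ι_{x,x₀}(p(x₀ + αx, x)⁻¹)`. -/
def iotaCoeff (α : ℂˣ) (p : MvPolynomial (Fin 2) ℂ) : (Fin 2 → ℤ) → ℂ :=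
  fun m => ((iotaInv α p).coeff (m 0)).coeff (m 1)

lemma lexB_lcoeff (f : LaurentSeries (LaurentSeries ℂ)) :
    LexB fun m => (f.coeff (m 0)).coeff (m 1) := by
  refine ⟨⟨f.order, fun m hm => HahnSeries.order_le_of_coeff_ne_zero fun h => hm ?_⟩,
    fun j => ⟨(f.coeff j).order, fun m hm hj => HahnSeries.order_le_of_coeff_ne_zero ?_⟩⟩
  · simp only [h]; rfl
  · subst hj; exact hm

lemma lcoeff_one_zero : lcoeff coeffHom 1 0 = 1 := by
  simp [lcoeff, coeffHom]

lemma lcoeff_one_of_ne {m : Fin 2 → ℤ} (h : m ≠ 0) : lcoeff coeffHom 1 m = 0 := by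
  unfold lcoeff
  rw [HahnSeries.coeff_one]
  split_ifs with h0
  · change (1 : LaurentSeries ℂ).coeff (m 1) = 0
    rw [HahnSeries.coeff_one, if_neg]
    intro h1
    apply h
    ext u; fin_cases u
    · exact h0
    · exact h1
  · rw [map_zero]; rfl

lemma act_iotaCoeff (α : ℂˣ) {p : MvPolynomial (Fin 2) ℂ} (hp : p ≠ 0) :
    act (tau (α : ℂ) 0 1 p) (iotaCoeff α p) = lcoeff coeffHom 1 := by
  refine act_lcoeff_invSubst (κ := coeffHom) (fun a y => ?_) (fun y n => ?_) (fun h => ?_)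
    (lexB_lcoeff _) α hp
  · ext n
    simp [coeffHom]
  · have := HahnSeries.coeff_single_mul_add (r := (1 : ℂ)) (x := y) (a := n - 1) (b := 1)
    simp [coeffHom] at this ⊢
    rw [this]
  · have h3 := lcoeff_one_zero
    rw [h] at h3
    exact zero_ne_one h3

/-- The link with the definition of `modeProd`: the factor `p(x₀ + αx, x)` cancels against its
expanded inverse inside the convolution. -/
lemma isT2_conv (α : ℂˣ) {q : MvPolynomial (Fin 2) ℂ} (hq : q ≠ 0) {G : (Fin 2 → ℤ) → U}
    (hG : Laur (act q G)) : IsT2 α G (conv (iotaCoeff α q) (sub2 α (act q G))) := by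
  refine ⟨q, hq, hG, (lexB_lcoeff _).conv (hG.lexB_sub2 α), ?_⟩
  rw [act_conv (κ := iotaCoeff α q) (lexB_lcoeff _) (hG.lexB_sub2 α),
    act_iotaCoeff α hq, conv_single _ lcoeff_one_zero fun m => lcoeff_one_of_ne]

end Conv

/-! ### Two-variable relations inside series in many variables. -/

section Slice

variable {σ : Type*} [DecidableEq σ] {U U' : Type*} [AddCommGroup U] [Module ℂ U]
  [AddCommGroup U'] [Module ℂ U']

/-- A series as a series in `x_s, x_t`, the exponents of the other variables being given by `m`. -/
def slice (s t : σ) (m : σ → ℤ) (F : (σ → ℤ) → U) : (Fin 2 → ℤ) → U :=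
  fun n => F (Function.update (Function.update m s (n 0)) t (n 1))

lemma slice_self (s t : σ) (m : σ → ℤ) (F : (σ → ℤ) → U) : slice s t m F ![m s, m t] = F m := by
  simp [slice]

lemma slice_add (s t : σ) (m : σ → ℤ) (F G : (σ → ℤ) → U) :
    slice s t m (F + G) = slice s t m F + slice s t m G := rfl

lemma slice_smul (s t : σ) (m : σ → ℤ) (c : ℂ) (F : (σ → ℤ) → U) :
    slice s t m (c • F) = c • slice s t m F := rfl

lemma slice_X_left {s t : σ} (h : s ≠ t) (m : σ → ℤ) (F : (σ → ℤ) → U) :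
    slice s t m (act (X s) F) = act (X 0) (slice s t m F) := by
  ext n
  rw [slice, act_X, act_X, slice]
  congr 1
  ext u
  by_cases hs : u = s
  · subst hs; simp [h]
  · by_cases ht : u = t
    · subst ht; simp [hs]
    · simp [hs, ht]

lemma slice_X_right {s t : σ} (h : s ≠ t) (m : σ → ℤ) (F : (σ → ℤ) → U) :
    slice s t m (act (X t) F) = act (X 1) (slice s t m F) := by
  ext n
  rw [slice, act_X, act_X, slice]
  congr 1
  ext u
  by_cases hs : u = s
  · subst hs; simp [h]
  · by_cases ht : u = t
    · subst ht; simp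
    · simp [hs, ht]

lemma slice_X_of_ne {s t u : σ} (hs : u ≠ s) (ht : u ≠ t) (m : σ → ℤ) (F : (σ → ℤ) → U) :
    slice s t m (act (X u) F) = slice s t (m - Pi.single u 1) F := by
  ext n
  rw [slice, act_X, slice]
  congr 1
  ext v
  by_cases h1 : v = s
  · subst h1; by_cases h2 : v = t <;> simp [h2, hs.symm, ht.symm]
  · by_cases h2 : v = t
    · subst h2; simp [ht.symm]
    · simp [h1, h2]

/-- A relation between series that is compatible with the substitution `x₀ ↦ c x₁ + x₀`. -/
structure Semilin (c : ℂ) (R : ((Fin 2 → ℤ) → U) → ((Fin 2 → ℤ) → U) → Prop) : Prop where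
  add : ∀ {F H F' H'}, R F H → R F' H' → R (F + F') (H + H')
  smul : ∀ {F H} (a : ℂ), R F H → R (a • F) (a • H)
  act : ∀ {F H} (P : MvPolynomial (Fin 2) ℂ), R F H →
    R (NonlocalVA.act P F) (NonlocalVA.act (tau c 0 1 P) H)

lemma semilin_isT2 (α : ℂˣ) : Semilin (α : ℂ) (IsT2 (U := U) α) :=
  ⟨IsT2.add, fun a h => h.smul a, fun P h => h.act P⟩

/-- The relation `R` holds in the variables `x_s, x_t`. -/
def LiftRel (s t : σ) (R : ((Fin 2 → ℤ) → U) → ((Fin 2 → ℤ) → U) → Prop)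
    (G H : (σ → ℤ) → U) : Prop :=
  ∀ m, R (slice s t m G) (slice s t m H)

/-- Multiplication by a variable other than `x_s, x_t` only moves the frozen exponents, and the
relation is assumed for all of them; the variables `x_s, x_t` are covered by `Semilin`. -/
lemma LiftRel.act {s t : σ} (hst : s ≠ t) {c : ℂ}
    {R : ((Fin 2 → ℤ) → U) → ((Fin 2 → ℤ) → U) → Prop} (hR : Semilin c R) {G H : (σ → ℤ) → U}
    (h : LiftRel s t R G H) (P : MvPolynomial σ ℂ) :
    LiftRel s t R (act P G) (act (tau c s t P) H) := by
  induction P using MvPolynomial.induction_on generalizing G H with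
  | C a =>
    rw [tau_C, act_C, act_C]
    exact fun m => hR.smul a (h m)
  | add P Q hP hQ =>
    rw [act_add, map_add (tau c s t), act_add]
    exact fun m => hR.add (hP h m) (hQ h m)
  | mul_X P u hP =>
    rw [act_mul, map_mul (tau c s t), act_mul]
    refine hP fun m => ?_
    by_cases hs : u = s
    · subst hs
      have e : slice u t m (NonlocalVA.act (tau c u t (X u)) H) =
          NonlocalVA.act (tau c 0 1 (X 0)) (slice u t m H) := by
        rw [tau_X_self, tau_X_self, act_add, act_add, act_mul, act_mul, act_C, act_C, slice_add,
          slice_smul, slice_X_left hst, slice_X_right hst]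
      rw [slice_X_left hst, e]
      exact hR.act _ (h m)
    · rw [tau_X_of_ne c hs]
      by_cases ht : u = t
      · subst ht
        have := hR.act (X 1) (h m)
        rw [slice_X_right hst, slice_X_right hst]
        rwa [tau_X_of_ne c (by decide)] at this
      · rw [slice_X_of_ne hs ht, slice_X_of_ne hs ht]
        exact h _

/-- The substitution `x_s ↦ α x_t + x_s`, expanded in nonnegative powers of the new `x_s`. -/
def substVar (α : ℂˣ) (s t : σ) (F : (σ → ℤ) → U) : (σ → ℤ) → U :=
  fun m => sub2 α (slice s t m F) ![m s, m t]

lemma slice_update {s t : σ} (m : σ → ℤ) (i j : ℤ) (F : (σ → ℤ) → U) :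
    slice s t (Function.update (Function.update m s i) t j) F = slice s t m F := by
  ext n
  unfold slice
  congr 1
  ext u
  by_cases hs : u = s
  · subst hs; by_cases ht : u = t <;> simp [ht]
  · by_cases ht : u = t
    · subst ht; simp
    · simp [hs, ht]

lemma slice_substVar (α : ℂˣ) {s t : σ} (h : s ≠ t) (m : σ → ℤ) (F : (σ → ℤ) → U) :
    slice s t m (substVar α s t F) = sub2 α (slice s t m F) := by
  ext n
  rw [slice, substVar, slice_update]
  congr 1
  ext u
  fin_cases u <;> simp [h]

lemma liftRel_substVar (α : ℂˣ) {s t : σ} (h : s ≠ t) {F : (σ → ℤ) → U}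
    (hF : ∀ m, Laur (slice s t m F)) : LiftRel s t (IsT2 α) F (substVar α s t F) := by
  intro m
  rw [slice_substVar α h]
  exact (hF m).isT2 α

lemma LiftRel.unique {α : ℂˣ} {s t : σ} {G H H' : (σ → ℤ) → U} (h : LiftRel s t (IsT2 α) G H)
    (h' : LiftRel s t (IsT2 α) G H') : H = H' := by
  ext m
  rw [← slice_self s t m H, (h m).unique (h' m), slice_self]

/-- The form in which the characterization is applied: a polynomial in all variables may regularize
`G`, even though the relation between `G` and `H` concerns only two of them. -/
lemma LiftRel.eq_substVar {α : ℂˣ} {s t : σ} (hst : s ≠ t) {G H : (σ → ℤ) → U}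
    (h : LiftRel s t (IsT2 α) G H) {P : MvPolynomial σ ℂ}
    (hP : ∀ m, Laur (slice s t m (NonlocalVA.act P G))) :
    NonlocalVA.act (tau (α : ℂ) s t P) H = substVar α s t (NonlocalVA.act P G) :=
  (h.act hst (semilin_isT2 α) P).unique (liftRel_substVar α hst hP)

lemma Laur.slice {F : (σ → ℤ) → U} (hF : Laur F) {s t : σ} (h : s ≠ t) (m : σ → ℤ) :
    Laur (slice s t m F) := by
  obtain ⟨N, hN⟩ := hF
  refine ⟨N, fun n hn i => ?_⟩
  have := hN _ hn
  fin_cases i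
  · simpa [h] using this s
  · simpa using this t

/-- A coefficient in the new `x_s` is still a Laurent series in the other variables. The bound for
`x_t` deteriorates as `j` grows, so the whole substituted series need not be one. -/
lemma Laur.substVar_coeff {F : (σ → ℤ) → U} (hF : Laur F) (α : ℂˣ) {s t : σ} (h : s ≠ t) (j : ℤ) :
    ∃ N : ℤ, ∀ m, m s = j → substVar α s t F m ≠ 0 → ∀ u, u ≠ s → N ≤ m u := by
  obtain ⟨N, hN⟩ := hF
  refine ⟨min N (2 * N - j), fun m hj hm u hu => ?_⟩
  rw [substVar, sub2_apply] at hm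
  obtain ⟨i, hi⟩ := exists_of_finsum_ne_zero hm
  have := hN _ (right_ne_zero_of_smul hi)
  by_cases ht : u = t
  · subst ht
    have h0 := this s
    have h1 := this u
    simp [h] at h0 h1
    omega
  · have h0 := this u
    simp [hu, ht] at h0
    omega

end Slice

/-! ### The operations `a(x)_{(α,n)}b(x)` and the identity field. -/

section Modes

variable {W : Type*} [AddCommGroup W] [Module ℂ W]

lemma prodSeries_two (a b : FieldSpace W) (w : W) (m : Fin 2 → ℤ) :
    prodSeries ![a, b] w m = coeffEnd a (m 0) (coeffEnd b (m 1) w) := by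
  simp [prodSeries, List.ofFn_succ]

lemma exists_coeff_bound (f : LaurentSeries W) : ∃ N : ℤ, ∀ n, f.coeff n ≠ 0 → N ≤ n :=
  ⟨f.order, fun _ hn => HahnSeries.order_le_of_coeff_ne_zero hn⟩

lemma field_ext {a b : FieldSpace W} (h : ∀ w n, coeffEnd a n w = coeffEnd b n w) : a = b := by
  ext w n
  exact h w n

lemma coeffEnd_add (a b : FieldSpace W) (n : ℤ) :
    coeffEnd (a + b) n = coeffEnd a n + coeffEnd b n := by
  ext w; simp [coeffEnd]

lemma coeffEnd_smul (c : ℂ) (a : FieldSpace W) (n : ℤ) :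
    coeffEnd (c • a) n = c • coeffEnd a n := by
  ext w; simp [coeffEnd]

lemma coeffEnd_zero (n : ℤ) : coeffEnd (0 : FieldSpace W) n = 0 := by
  ext w; simp [coeffEnd]

/-- `y j` is the coefficient of `x₀ ^ j` in `Y_𝓔^{(α)}(a(x), x₀) b(x)`. -/
def IsY (α : ℂˣ) (a b : FieldSpace W) (y : ℤ → FieldSpace W) : Prop :=
  ∀ w, IsT2 α (prodSeries ![a, b] w) fun m => coeffEnd (y (m 0)) (m 1) w

lemma IsY.unique {α : ℂˣ} {a b : FieldSpace W} {y y' : ℤ → FieldSpace W} (h : IsY α a b y)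
    (h' : IsY α a b y') : y = y' := by
  ext1 j
  refine field_ext fun w n => ?_
  exact congrFun ((h w).unique (h' w)) ![j, n]

lemma IsY.add_left {α : ℂˣ} {a a' b : FieldSpace W} {y y' : ℤ → FieldSpace W} (h : IsY α a b y)
    (h' : IsY α a' b y') : IsY α (a + a') b (y + y') := by
  intro w
  convert (h w).add (h' w) using 1
  · ext m; simp [prodSeries_two, coeffEnd_add]
  · ext m; simp [coeffEnd_add]

lemma IsY.add_right {α : ℂˣ} {a b b' : FieldSpace W} {y y' : ℤ → FieldSpace W} (h : IsY α a b y)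
    (h' : IsY α a b' y') : IsY α a (b + b') (y + y') := by
  intro w
  convert (h w).add (h' w) using 1
  · ext m; simp [prodSeries_two, coeffEnd_add]
  · ext m; simp [coeffEnd_add]

lemma IsY.smul_left {α : ℂˣ} {a b : FieldSpace W} {y : ℤ → FieldSpace W} (h : IsY α a b y)
    (c : ℂ) : IsY α (c • a) b (c • y) := by
  intro w
  convert (h w).smul c using 1
  · ext m; simp [prodSeries_two, coeffEnd_smul]
  · ext m; simp [coeffEnd_smul]

lemma IsY.smul_right {α : ℂˣ} {a b : FieldSpace W} {y : ℤ → FieldSpace W} (h : IsY α a b y)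
    (c : ℂ) : IsY α a (c • b) (c • y) := by
  intro w
  convert (h w).smul c using 1
  · ext m; simp [prodSeries_two, coeffEnd_smul]
  · ext m; simp [coeffEnd_smul]

/-- An element of `Hom(W, W((x)))` with given coefficients. -/
def fieldOf (f : W → ℤ → W) (hb : ∀ w, BddBelow (Function.support (f w)))
    (hadd : ∀ v w, f (v + w) = f v + f w) (hsmul : ∀ (c : ℂ) w, f (c • w) = c • f w) :
    FieldSpace W where
  toFun w := HahnSeries.ofSuppBddBelow (f w) (hb w)
  map_add' v w := by ext n; simp [hadd]
  map_smul' c w := by ext n; simp [hsmul]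

lemma fieldYWith_eq (p : MvPolynomial (Fin 2) ℂ) (α : ℂˣ) (a b : FieldSpace W) (w : W)
    (m : Fin 2 → ℤ) : fieldYWith p α a b w (m 0) (m 1) =
      conv (iotaCoeff α p) (sub2 α (act p (prodSeries ![a, b] w))) m := by
  rw [fieldYWith, polyMul_eq_act]
  rfl

/-- Linearity in `w` of the explicit coefficients comes from uniqueness, which makes them fields;
the polynomial `p` serves all `w`, which gives one truncation bound. -/
lemma exists_isY (α : ℂˣ) {a b : FieldSpace W} (h : ∃ p, Regularizes p a b) :
    ∃ y, IsY α a b y ∧ (∀ n : ℤ, toSeries (y (-n - 1)) = modeProd α n a b) ∧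
      ∃ N : ℤ, ∀ j < N, y j = 0 := by
  obtain ⟨hp, hp'⟩ := h.choose_spec
  set p := h.choose with hpdef
  set H : W → (Fin 2 → ℤ) → W := fun w m => fieldYWith p α a b w (m 0) (m 1) with hH
  have hL : ∀ w, Laur (act p (prodSeries ![a, b] w)) := fun w => by
    have := hp' w
    rwa [polyMul_eq_act] at this
  have hT : ∀ w, IsT2 α (prodSeries ![a, b] w) (H w) := fun w => by
    have := isT2_conv α hp (hL w)
    convert this using 1
    ext m
    exact fieldYWith_eq p α a b w m
  have hadd : ∀ v w, H (v + w) = H v + H w := fun v w => by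
    refine (hT _).unique ?_
    convert (hT v).add (hT w) using 1
    ext m; simp [prodSeries_two]
  have hsmul : ∀ (c : ℂ) w, H (c • w) = c • H w := fun c w => by
    refine (hT _).unique ?_
    convert (hT w).smul c using 1
    ext m; simp [prodSeries_two]
  have hb : ∀ (j : ℤ) w, BddBelow (Function.support fun k : ℤ => H w ![j, k]) := fun j w => by
    obtain ⟨N, hN⟩ := (hT w).lexB.2 j
    exact ⟨N, fun k hk => hN _ hk rfl⟩
  let y : ℤ → FieldSpace W := fun j => fieldOf (fun w k => H w ![j, k]) (hb j)
    (fun v w => by ext k; simp only [hadd]; rfl) (fun c w => by ext k; simp only [hsmul]; rfl)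
  have hy : ∀ w, (fun m : Fin 2 → ℤ => coeffEnd (y (m 0)) (m 1) w) = H w := fun w => rfl
  refine ⟨y, fun w => ?_, fun n => ?_, ?_⟩
  · rw [hy]; exact hT w
  · rw [modeProd, dif_pos h]
    rfl
  -- The image of `p` times `H w` is a substitution, hence without negative powers of `x₀`, and
  -- `exists_bound_of_act` bounds `H w` in terms of that image only.
  · have hτ : tau (α : ℂ) (0 : Fin 2) 1 p ≠ 0 := tau_ne_zero _ (by decide) hp
    obtain ⟨N, hN⟩ := exists_bound_of_act hτ
    refine ⟨N, fun j hj => field_ext fun w k => ?_⟩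
    rw [coeffEnd_zero]
    refine hN W (H w) (hT w).lexB (fun m hm => ?_) ![j, k] hj
    have : H w = conv (iotaCoeff α p) (sub2 α (act p (prodSeries ![a, b] w))) :=
      funext fun m => fieldYWith_eq p α a b w m
    rw [this, act_conv (κ := iotaCoeff α p) (lexB_lcoeff _) ((hL w).lexB_sub2 α),
      act_iotaCoeff α hp, conv_single _ lcoeff_one_zero fun m => lcoeff_one_of_ne,
      sub2_of_neg α _ hm]

lemma coeffEnd_id (n : ℤ) (w : W) : coeffEnd (idField W) n w = if n = 0 then w else 0 := by
  simp [coeffEnd, idField, HahnSeries.coeff_single]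

lemma field_laur (a : FieldSpace W) (w : W) : ∃ N : ℤ, ∀ n, coeffEnd a n w ≠ 0 → N ≤ n :=
  exists_coeff_bound (a w)

lemma laur_id_left (b : FieldSpace W) (w : W) : Laur (prodSeries ![idField W, b] w) := by
  obtain ⟨N, hN⟩ := field_laur b w
  refine ⟨min N 0, fun m hm i => ?_⟩
  rw [prodSeries_two, coeffEnd_id] at hm
  split_ifs at hm with h
  · have := hN _ hm
    fin_cases i
    · exact (min_le_right _ _).trans h.ge
    · exact (min_le_left _ _).trans this
  · exact absurd rfl hm

lemma laur_id_right (a : FieldSpace W) (w : W) : Laur (prodSeries ![a, idField W] w) := by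
  obtain ⟨N, hN⟩ := field_laur a w
  refine ⟨min N 0, fun m hm i => ?_⟩
  rw [prodSeries_two, coeffEnd_id] at hm
  split_ifs at hm with h
  · have := hN _ hm
    fin_cases i
    · exact (min_le_left _ _).trans this
    · exact (min_le_right _ _).trans h.ge
  · rw [map_zero] at hm; exact absurd rfl hm

/-- `Y_𝓔(1_W, x₀) b(x) = b(x)`. -/
lemma isY_id_left (b : FieldSpace W) :
    IsY 1 (idField W) b fun j => if j = 0 then b else 0 := by
  intro w
  convert (laur_id_left b w).isT2 1 using 1
  ext m
  rw [sub2_apply, finsum_eq_single _ 0]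
  · rw [prodSeries_two, coeffEnd_id]
    simp only [subCoeff, Matrix.cons_val_zero, Matrix.cons_val_one]
    rcases lt_trichotomy (m 0) 0 with h | h | h
    · rw [if_neg h.ne, if_neg (by omega), coeffEnd_zero]; simp
    · simp [h]
    · rw [if_neg h.ne', if_pos h.le, coeffEnd_zero, Ring.choose_zero_pos ℤ (by omega)]; simp
  · intro i hi
    rw [prodSeries_two, coeffEnd_id, if_neg (by simpa using hi), smul_zero]

lemma isY_id_right_of_neg {α : ℂˣ} {a : FieldSpace W} {y : ℤ → FieldSpace W}
    (hy : IsY α a (idField W) y) {j : ℤ} (hj : j < 0) : y j = 0 := by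
  refine field_ext fun w k => ?_
  have := congrFun ((hy w).unique ((laur_id_right a w).isT2 α)) ![j, k]
  rw [coeffEnd_zero]
  exact this.trans (sub2_of_neg α _ hj)

/-- The constant term of `Y_𝓔^{(α)}(a(x), x₀) 1_W` is `a(αx)`. -/
lemma isY_id_right_zero {α : ℂˣ} {a : FieldSpace W} {y : ℤ → FieldSpace W}
    (hy : IsY α a (idField W) y) : y 0 = rescale α a := by
  refine field_ext fun w k => ?_
  have := congrFun ((hy w).unique ((laur_id_right a w).isT2 α)) ![0, k]
  refine this.trans ?_
  rw [sub2_apply, finsum_eq_single _ k]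
  · rw [prodSeries_two, coeffEnd_id]
    simp [subCoeff, coeffEnd, rescale, rescaleLaurent]
  · intro i hi
    rw [prodSeries_two, coeffEnd_id, if_neg (by simp; omega), map_zero, smul_zero]

lemma rescale_one (a : FieldSpace W) : rescale 1 a = a := by
  ext w n
  simp [rescale, rescaleLaurent]

end Modes

/-! ### Products of polynomials in pairs of variables. -/

section PairMonoid

variable {σ τ : Type*}

/-- The products of nonzero polynomials in at most two of the variables. -/
def pairMonoid (σ : Type*) : Submonoid (MvPolynomial σ ℂ) :=
  Submonoid.closure {p | p ≠ 0 ∧ ∃ i j, p ∈ Algebra.adjoin ℂ {X i, X j}}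

lemma mem_adjoin_pair {i j : σ} {p : MvPolynomial σ ℂ} :
    p ∈ Algebra.adjoin ℂ {X i, X j} ↔ ∃ g : MvPolynomial (Fin 2) ℂ, rename ![i, j] g = p := by
  have h : ({X i, X j} : Set (MvPolynomial σ ℂ)) = Set.range (X ∘ ![i, j]) := by
    ext q
    simp [Fin.exists_fin_two, eq_comm]
  rw [h, Algebra.adjoin_range_eq_range_aeval, AlgHom.mem_range]
  have h2 : (aeval (X ∘ ![i, j]) : MvPolynomial (Fin 2) ℂ →ₐ[ℂ] MvPolynomial σ ℂ) =
      rename ![i, j] := by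
    ext u : 1; simp
  rw [h2]

lemma rename_mem_pairMonoid {f : σ → τ} (hf : Function.Injective f) {Q : MvPolynomial σ ℂ}
    (hQ : Q ∈ pairMonoid σ) : rename f Q ∈ pairMonoid τ := by
  induction hQ using Submonoid.closure_induction with
  | mem p hp =>
    obtain ⟨hp, i, j, h⟩ := hp
    refine Submonoid.subset_closure ⟨?_, f i, f j, ?_⟩
    · rw [Ne, ← map_zero (rename f), (rename_injective f hf).eq_iff]
      exact hp
    · obtain ⟨g, rfl⟩ := mem_adjoin_pair.1 h
      refine mem_adjoin_pair.2 ⟨g, ?_⟩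
      rw [rename_rename]
      congr 2
      ext u; fin_cases u <;> rfl
  | one => rw [map_one]; exact one_mem _
  | mul p q _ _ hp hq => rw [map_mul]; exact mul_mem hp hq

lemma pairProd_mul (r : ℕ) (p q : MvPolynomial (Fin 2) ℂ) :
    pairProd r (p * q) = pairProd r p * pairProd r q := by
  simp only [pairProd, map_mul, Finset.prod_mul_distrib]

lemma pairProd_one (r : ℕ) : pairProd r 1 = 1 := by
  simp [pairProd]

lemma pairProd_mem (r : ℕ) {p : MvPolynomial (Fin 2) ℂ} (hp : p ≠ 0) :
    pairProd r p ∈ pairMonoid (Fin r) := by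
  refine Submonoid.prod_mem _ fun ij hij => Submonoid.subset_closure ⟨?_, ij.1, ij.2, ?_⟩
  · have hlt : ij.1 < ij.2 := by simpa using hij
    have hinj : Function.Injective ![ij.1, ij.2] := by
      intro u v huv
      fin_cases u <;> fin_cases v <;> simp_all [hlt.ne, hlt.ne']
    rw [Ne, ← map_zero (rename ![ij.1, ij.2]), (rename_injective _ hinj).eq_iff]
    exact hp
  · exact mem_adjoin_pair.2 ⟨p, rfl⟩

lemma exists_dvd_pairProd_of_ne {r : ℕ} {i j : Fin r} (hij : i ≠ j) (g : MvPolynomial (Fin 2) ℂ)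
    (hg : rename ![i, j] g ≠ 0) : ∃ p ≠ 0, rename ![i, j] g ∣ pairProd r p := by
  rcases lt_or_gt_of_ne hij with h | h
  · refine ⟨g, fun h0 => hg (by rw [h0, map_zero]), ?_⟩
    exact Finset.dvd_prod_of_mem (fun ij : Fin r × Fin r => rename ![ij.1, ij.2] g)
      (a := (i, j)) (by simpa using h)
  · have e : rename ![i, j] g = rename ![j, i] (rename ![1, 0] g) := by
      rw [rename_rename]
      congr 2
      ext u; fin_cases u <;> rfl
    refine ⟨rename ![1, 0] g, fun h0 => hg (by rw [e, h0, map_zero]), ?_⟩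
    rw [e]
    exact Finset.dvd_prod_of_mem
      (fun ij : Fin r × Fin r => rename ![ij.1, ij.2] (rename ![1, 0] g))
      (a := (j, i)) (by simpa using h)

/-- This frees quasi compatibility from the exact shape `∏_{i<j} p(x_i, x_j)`: different factors for
different pairs are absorbed by multiplying them into a single `p`. Two variables are needed, since
for `r = 1` the product is empty. -/
lemma exists_dvd_pairProd {r : ℕ} (hr : 2 ≤ r) {Q : MvPolynomial (Fin r) ℂ}
    (hQ : Q ∈ pairMonoid (Fin r)) : ∃ p ≠ 0, Q ∣ pairProd r p := by
  induction hQ using Submonoid.closure_induction with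
  | mem p hp =>
    obtain ⟨hp, i, j, h⟩ := hp
    obtain ⟨g, rfl⟩ := mem_adjoin_pair.1 h
    by_cases hij : i = j
    · subst hij
      have : Nontrivial (Fin r) := Fin.nontrivial_iff_two_le.2 hr
      obtain ⟨k, hk⟩ := exists_ne i
      -- A polynomial in `x_i` alone is regarded as one in `x_i` and an idle variable `x_k`.
      have e : rename ![i, i] g = rename ![i, k] (rename (fun _ => (0 : Fin 2)) g) := by
        rw [rename_rename]
        congr 2
        ext u; fin_cases u <;> rfl
      rw [e] at hp ⊢
      exact exists_dvd_pairProd_of_ne hk.symm _ hp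
    · exact exists_dvd_pairProd_of_ne hij _ hp
  | one => exact ⟨1, one_ne_zero, one_dvd _⟩
  | mul P Q _ _ hP hQ =>
    obtain ⟨p, hp, hp'⟩ := hP
    obtain ⟨q, hq, hq'⟩ := hQ
    exact ⟨p * q, mul_ne_zero hp hq, by rw [pairProd_mul]; exact mul_dvd_mul hp' hq'⟩

/-- An operator on series that takes the variables `x_s` to `x_{f s}`. -/
lemma map_act_rename {U : Type*} [AddCommGroup U] [Module ℂ U] (f : σ → τ)
    (T : ((σ → ℤ) → U) →ₗ[ℂ] ((τ → ℤ) → U))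
    (hT : ∀ s F, T (act (X s) F) = act (X (f s)) (T F)) (Q : MvPolynomial σ ℂ) (F : (σ → ℤ) → U) :
    T (act Q F) = act (rename f Q) (T F) := by
  induction Q using MvPolynomial.induction_on generalizing F with
  | C a => rw [rename_C, act_C, act_C, map_smul]
  | add P Q hP hQ => rw [map_add (rename f), act_add, act_add, map_add T, hP, hQ]
  | mul_X P s hP => rw [act_mul, map_mul (rename f), act_mul, hP, hT, rename_X]

end PairMonoid

/-! ### Quasi compatibility of lists of fields labelled by variables. -/

section Labelled

variable {σ τ : Type*} {W : Type*} [AddCommGroup W] [Module ℂ W]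

/-- The coefficients of the product of the fields of a list, each in its own variable. -/
def ser (L : List (σ × FieldSpace W)) (m : σ → ℤ) : Module.End ℂ W :=
  (L.map fun p => coeffEnd p.2 (m p.1)).prod

lemma ser_append (L L' : List (σ × FieldSpace W)) (m : σ → ℤ) :
    ser (L ++ L') m = ser L m * ser L' m := by
  simp [ser]

lemma ser_cons (p : σ × FieldSpace W) (L : List (σ × FieldSpace W)) (m : σ → ℤ) :
    ser (p :: L) m = coeffEnd p.2 (m p.1) * ser L m := by
  simp [ser]

lemma ser_map (f : σ → τ) (L : List (σ × FieldSpace W)) (m : τ → ℤ) :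
    ser (L.map (Prod.map f id)) m = ser L (m ∘ f) := by
  simp [ser, Function.comp_def]

lemma ser_congr {L : List (σ × FieldSpace W)} {m m' : σ → ℤ}
    (h : ∀ s ∈ L.map Prod.fst, m s = m' s) : ser L m = ser L m' := by
  unfold ser
  congr 1
  refine List.map_congr_left fun p hp => ?_
  rw [h _ (List.mem_map_of_mem hp)]

/-- Each variable occurs exactly once. -/
def Valid (L : List (σ × FieldSpace W)) : Prop :=
  (L.map Prod.fst).Nodup ∧ ∀ s, s ∈ L.map Prod.fst

/-- Quasi compatibility for a list of fields in given variables. -/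
def LabelledQC (L : List (σ × FieldSpace W)) : Prop :=
  ∃ Q ∈ pairMonoid σ, ∀ w, Laur (act Q fun m => ser L m w)

lemma LabelledQC.map_equiv {L : List (σ × FieldSpace W)} (h : LabelledQC L) (e : σ ≃ τ) :
    LabelledQC (L.map (Prod.map e id)) := by
  classical
  obtain ⟨Q, hQ, hL⟩ := h
  refine ⟨rename e Q, rename_mem_pairMonoid e.injective hQ, fun w => ?_⟩
  let T : ((σ → ℤ) → W) →ₗ[ℂ] ((τ → ℤ) → W) :=
    { toFun := fun F m => F (m ∘ e)
      map_add' := fun _ _ => rfl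
      map_smul' := fun _ _ => rfl }
  have hT := map_act_rename e T (fun s F => by
    ext m
    change act (X s) F (m ∘ e) = act (X (e s)) (T F) m
    rw [act_X, act_X]
    change _ = F ((m - Pi.single (e s) 1) ∘ e)
    congr 1
    ext u
    by_cases hu : u = s
    · subst hu; simp
    · simp [hu]) Q fun m => ser L m w
  have e1 : (fun m => ser (L.map (Prod.map e id)) m w) = T fun m => ser L m w := by
    ext m
    rw [ser_map]
    rfl
  rw [e1, ← hT]
  obtain ⟨N, hN⟩ := hL w
  refine ⟨N, fun m hm i => ?_⟩
  have := hN (m ∘ e) hm (e.symm i)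
  simpa using this

lemma ser_ofFn {r : ℕ} (ψ : Fin r → FieldSpace W) (m : Fin r → ℤ) (w : W) :
    ser (List.ofFn fun i => (i, ψ i)) m w = prodSeries ψ w m := by
  simp [ser, prodSeries, List.map_ofFn, Function.comp_def]

lemma valid_ofFn {r : ℕ} (ψ : Fin r → FieldSpace W) : Valid (List.ofFn fun i => (i, ψ i)) := by
  have : (List.ofFn fun i => (i, ψ i)).map Prod.fst = List.ofFn (fun i : Fin r => i) := by
    rw [List.map_ofFn]; rfl
  constructor
  · rw [this, List.nodup_ofFn]
    exact fun _ _ h => h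
  · intro s
    rw [this, List.mem_ofFn]
    exact ⟨s, rfl⟩

lemma map_snd_ofFn {r : ℕ} (ψ : Fin r → FieldSpace W) :
    (List.ofFn fun i => (i, ψ i)).map Prod.snd = List.ofFn ψ := by
  rw [List.map_ofFn]; rfl

lemma labelledQC_ofFn {r : ℕ} (ψ : Fin r → FieldSpace W) :
    LabelledQC (List.ofFn fun i => (i, ψ i)) ↔ QuasiCompatibleSeq ψ := by
  have hser : ∀ w, (fun m => ser (List.ofFn fun i => (i, ψ i)) m w) = prodSeries ψ w :=
    fun w => funext fun m => ser_ofFn ψ m w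
  constructor
  · rintro ⟨Q, hQ, h⟩
    -- Sequences of length at most one need no regularization: a single field already takes values
    -- in Laurent series.
    rcases Nat.lt_or_ge r 2 with hr | hr
    · refine ⟨1, one_ne_zero, fun w => ?_⟩
      rw [pairProd_one, polyMul_eq_act, act_one]
      interval_cases r
      · exact ⟨0, fun m _ i => i.elim0⟩
      · obtain ⟨N, hN⟩ := field_laur (ψ 0) w
        refine ⟨N, fun m hm i => ?_⟩
        rw [Subsingleton.elim i 0]
        refine hN _ ?_
        simpa [prodSeries, List.ofFn_succ] using hm
    · obtain ⟨p, hp, R, hR⟩ := exists_dvd_pairProd hr hQ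
      refine ⟨p, hp, fun w => ?_⟩
      rw [polyMul_eq_act, hR, mul_comm, act_mul, ← hser]
      exact (h w).act R
  · rintro ⟨p, hp, h⟩
    refine ⟨pairProd r p, pairProd_mem r hp, fun w => ?_⟩
    rw [hser, ← polyMul_eq_act]
    exact h w

/-- Quasi compatibility for a list of fields. -/
def ListQC (L : List (FieldSpace W)) : Prop := QuasiCompatibleSeq L.get

/-- The names of the variables are immaterial. Lists of fields suit concatenation, while labels
allow a variable to be added or removed without renumbering the others. -/
lemma Valid.listQC_iff {L : List (σ × FieldSpace W)} (hL : Valid L) :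
    ListQC (L.map Prod.snd) ↔ LabelledQC L := by
  let f : Fin (L.map Prod.snd).length → σ := fun i => (L.map Prod.fst).get (i.cast (by simp))
  have hf : Function.Bijective f := by
    constructor
    · intro i j hij
      have := List.nodup_iff_injective_get.1 hL.1 hij
      simpa using this
    · intro s
      obtain ⟨i, hi⟩ := List.get_of_mem (hL.2 s)
      exact ⟨i.cast (by simp), by simpa [f] using hi⟩
  let e := Equiv.ofBijective f hf
  have key : (List.ofFn fun i => (i, (L.map Prod.snd).get i)).map (Prod.map e id) = L := by
    apply List.ext_getElem
    · simp
    · intro n h1 h2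
      simp [e, f]
  rw [ListQC, ← labelledQC_ofFn]
  constructor
  · intro h
    have := h.map_equiv e
    rwa [key] at this
  · intro h
    have h' : LabelledQC ((List.ofFn fun i => (i, (L.map Prod.snd).get i)).map (Prod.map e id)) := by
      rwa [key]
    have := h'.map_equiv e.symm
    rw [List.map_map] at this
    convert this using 1
    symm
    convert List.map_id _ using 2
    ext p <;> simp

lemma listQC_ofFn {r : ℕ} (ψ : Fin r → FieldSpace W) :
    ListQC (List.ofFn ψ) ↔ QuasiCompatibleSeq ψ := by
  rw [← labelledQC_ofFn, ← (valid_ofFn ψ).listQC_iff, map_snd_ofFn]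

lemma quasiCompatible_iff {S : Set (FieldSpace W)} :
    QuasiCompatible S ↔ ∀ L : List (FieldSpace W), (∀ a ∈ L, a ∈ S) → ListQC L := by
  constructor
  · exact fun h L hL => h _ _ fun i => hL _ (List.get_mem _ _)
  · intro h r ψ hψ
    rw [← listQC_ofFn]
    refine h _ fun a ha => ?_
    obtain ⟨i, rfl⟩ := (List.mem_ofFn' _ _).1 ha
    exact hψ i

lemma exists_valid_append (L₁ L₂ : List (FieldSpace W)) :
    ∃ (r : ℕ) (l₁ l₂ : List (Fin r × FieldSpace W)), Valid (l₁ ++ l₂) ∧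
      l₁.map Prod.snd = L₁ ∧ l₂.map Prod.snd = L₂ := by
  have h1 := valid_ofFn (L₁ ++ L₂).get
  have h2 := map_snd_ofFn (L₁ ++ L₂).get
  rw [List.ofFn_get] at h2
  obtain ⟨l₁, l₂, e, h3, h4⟩ := List.map_eq_append_iff.1 h2
  rw [e] at h1
  exact ⟨_, l₁, l₂, h1, h3, h4⟩

lemma exists_valid (L₁ L₂ : List (FieldSpace W)) (c : FieldSpace W) :
    ∃ (r : ℕ) (l₁ l₂ : List (Fin r × FieldSpace W)) (t : Fin r), Valid (l₁ ++ (t, c) :: l₂) ∧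
      l₁.map Prod.snd = L₁ ∧ l₂.map Prod.snd = L₂ := by
  obtain ⟨r, l₁, l', h1, h3, h4⟩ := exists_valid_append L₁ (c :: L₂)
  obtain ⟨⟨t, c'⟩, l₂, rfl, rfl, h6⟩ := List.map_eq_cons_iff.1 h4
  exact ⟨r, l₁, l₂, t, h1, h3, h6⟩

lemma Valid.replace {l₁ l₂ : List (σ × FieldSpace W)} {t : σ} {c c' : FieldSpace W}
    (h : Valid (l₁ ++ (t, c) :: l₂)) : Valid (l₁ ++ (t, c') :: l₂) := by
  unfold Valid at *
  simpa using h

end Labelled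

/-! ### Extracting coefficients in one distinguished variable. -/

section Coefficients

variable {σ : Type*} {U : Type*} [AddCommGroup U] [Module ℂ U]

/-- The coefficient of `x_none ^ n`. -/
def optCoeff (F : (Option σ → ℤ) → U) (n : ℤ) : (σ → ℤ) → U := fun m => F fun o => o.elim n m

lemma optCoeff_act (P : MvPolynomial (Option σ) ℂ) (F : (Option σ → ℤ) → U) (n : ℤ) :
    optCoeff (act P F) n =
      (optionEquivLeft ℂ σ P).sum fun i q => act q (optCoeff F (n - i)) := by
  induction P using MvPolynomial.induction_on' with
  | add P Q hP hQ =>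
    rw [map_add (optionEquivLeft ℂ σ), Polynomial.sum_add_index, ← hP, ← hQ, act_add]
    · rfl
    · intro i; rw [map_zero]; rfl
    · intro i p q; rw [act_add]
  | monomial d c =>
    rw [optionEquivLeft_monomial, Polynomial.sum_monomial_index]
    · ext m
      rw [act_monomial]
      change act (monomial d c) F _ = _
      rw [act_monomial]
      unfold optCoeff
      congr 2
      ext o
      cases o <;> simp
    · rw [map_zero]; rfl

/-- If the coefficients of `P F` are Laurent series, then so are those of `F` after multiplication
by powers of the trailing coefficient of `P`. -/
lemma laur_trailingCoeff_pow {P : Polynomial (MvPolynomial σ ℂ)} (hP : P ≠ 0)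
    {F : ℤ → (σ → ℤ) → U} {K : ℤ} (hK : ∀ n < K, F n = 0)
    (h : ∀ n : ℤ, Laur (P.sum fun i q => act q (F (n - i)))) (k : ℕ) :
    ∀ n < K + k, Laur (act (P.trailingCoeff ^ k) (F n)) := by
  induction k with
  | zero =>
    intro n hn
    rw [hK n (by simpa using hn), map_zero]
    exact Laur.zero
  | succ k ih =>
    intro n hn
    have h1 := h (n + P.natTrailingDegree)
    rw [Polynomial.sum_def, ← Finset.add_sum_erase _ _
      (Polynomial.natTrailingDegree_mem_support_of_nonzero hP)] at h1
    set S := ∑ i ∈ P.support.erase P.natTrailingDegree,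
      act (P.coeff i) (F (n + P.natTrailingDegree - i)) with hS
    have h2 : Laur (act (P.trailingCoeff ^ k) S) := by
      rw [hS, map_sum]
      -- The remaining terms have `i` above the trailing degree, hence involve `F` at indices below
      -- `n`, which `ih` regularizes by the power `k`. Solving for the trailing term costs one more
      -- factor.
      refine Finset.sum_induction _ Laur (fun _ _ => Laur.add) Laur.zero fun i hi => ?_
      rw [act_comm]
      refine (ih _ ?_).act _
      have h3 := Polynomial.natTrailingDegree_le_of_mem_supp i (Finset.mem_of_mem_erase hi)
      have h4 := Finset.ne_of_mem_erase hi
      push_cast at hn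
      omega
    have h5 := (h1.act (P.trailingCoeff ^ k)).add (h2.smul (-1))
    rw [map_add, add_sub_cancel_right] at h5
    have h6 : act (P.trailingCoeff ^ (k + 1)) (F n) =
        act (P.trailingCoeff ^ k) (act (P.coeff P.natTrailingDegree) (F n)) := by
      rw [pow_succ, act_mul]; rfl
    rw [h6]
    convert h5 using 1
    rw [neg_one_smul]
    abel

/-- Under `x_none ↦ α x_t + x_none` the coefficients in `x_none` of a two-variable polynomial
involve the same labels with `none` replaced by `t`; possibly both become `t`, which is why
one-variable factors are allowed in `pairMonoid`. -/
lemma coeff_tau_mem (α : ℂ) [DecidableEq σ] (t : σ) {i j : Option σ} {p : MvPolynomial (Option σ) ℂ}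
    (hp : p ∈ Algebra.adjoin ℂ {X i, X j}) (n : ℕ) :
    (optionEquivLeft ℂ σ (tau α none (some t) p)).coeff n ∈
      Algebra.adjoin ℂ ({X (i.getD t), X (j.getD t)} : Set (MvPolynomial σ ℂ)) := by
  set S := Algebra.adjoin ℂ ({X (i.getD t), X (j.getD t)} : Set (MvPolynomial σ ℂ)) with hS
  have hX : ∀ u : Option σ, X (u.getD t) ∈ S → ∀ n,
      (optionEquivLeft ℂ σ (tau α none (some t) (X u))).coeff n ∈ S := by
    intro u hu n
    cases u with
    | none =>
      rw [tau_X_self, map_add, map_mul, optionEquivLeft_X_none, optionEquivLeft_X_some,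
        optionEquivLeft_C, ← Polynomial.C_mul, Polynomial.coeff_add, Polynomial.coeff_C,
        Polynomial.coeff_X]
      refine add_mem ?_ ?_
      · split_ifs
        · exact mul_mem (S.algebraMap_mem α) hu
        · exact zero_mem _
      · split_ifs
        · exact one_mem _
        · exact zero_mem _
    | some u =>
      rw [tau_X_of_ne _ (by simp), optionEquivLeft_X_some, Polynomial.coeff_C]
      split_ifs
      · exact hu
      · exact zero_mem _
  induction hp using Algebra.adjoin_induction generalizing n with
  | mem p hp =>
    rcases hp with rfl | rfl
    · exact hX _ (Algebra.subset_adjoin (by simp)) n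
    · exact hX _ (Algebra.subset_adjoin (by simp)) n
  | algebraMap c =>
    rw [MvPolynomial.algebraMap_eq, tau_C, optionEquivLeft_C, Polynomial.coeff_C]
    split_ifs
    · exact S.algebraMap_mem c
    · exact zero_mem _
  | add p q _ _ hp hq =>
    rw [map_add, map_add, Polynomial.coeff_add]
    exact add_mem (hp n) (hq n)
  | mul p q _ _ hp hq =>
    rw [map_mul, map_mul, Polynomial.coeff_mul]
    exact sum_mem fun x _ => mul_mem (hp _) (hq _)

lemma ne_zero_of_mem_pairMonoid {Q : MvPolynomial σ ℂ} (hQ : Q ∈ pairMonoid σ) : Q ≠ 0 := by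
  induction hQ using Submonoid.closure_induction with
  | mem p hp => exact hp.1
  | one => exact one_ne_zero
  | mul p q _ _ hp hq => exact mul_ne_zero hp hq

lemma optionEquivLeft_tau_ne_zero (α : ℂ) [DecidableEq σ] (t : σ) {p : MvPolynomial (Option σ) ℂ}
    (hp : p ≠ 0) : optionEquivLeft ℂ σ (tau α none (some t) p) ≠ 0 := by
  rw [Ne, EmbeddingLike.map_eq_zero_iff]
  exact tau_ne_zero α (by simp) hp

lemma trailingCoeff_tau_mem (α : ℂ) [DecidableEq σ] (t : σ) {Q : MvPolynomial (Option σ) ℂ}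
    (hQ : Q ∈ pairMonoid (Option σ)) :
    (optionEquivLeft ℂ σ (tau α none (some t) Q)).trailingCoeff ∈ pairMonoid σ := by
  induction hQ using Submonoid.closure_induction with
  | mem p hp =>
    obtain ⟨hp, i, j, h⟩ := hp
    exact Submonoid.subset_closure ⟨Polynomial.trailingCoeff_nonzero_iff_nonzero.2
      (optionEquivLeft_tau_ne_zero α t hp), _, _, coeff_tau_mem α t h _⟩
  | one =>
    rw [map_one, map_one]
    simp [Polynomial.trailingCoeff]
  | mul p q _ _ hp hq =>
    rw [map_mul, map_mul, Polynomial.trailingCoeff_mul]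
    exact mul_mem hp hq

end Coefficients

/-! ### Replacing entries of a quasi compatible list. -/

section Replace

variable {σ : Type*} {W : Type*} [AddCommGroup W] [Module ℂ W]

/-- A product of series in a quasi compatible list can be replaced by its modes. -/
lemma LabelledQC.mode [DecidableEq σ] {α : ℂˣ} {a b : FieldSpace W} {y : ℤ → FieldSpace W}
    (hy : IsY α a b y) {K : ℤ} (hK : ∀ j < K, y j = 0) {l₁ l₂ : List (σ × FieldSpace W)} {t : σ}
    (h₁ : t ∉ l₁.map Prod.fst) (h₂ : t ∉ l₂.map Prod.fst)
    (h : LabelledQC (l₁.map (Prod.map some id) ++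
      (none, a) :: (some t, b) :: l₂.map (Prod.map some id))) (j : ℤ) :
    LabelledQC (l₁ ++ (t, y j) :: l₂) := by
  obtain ⟨Q, hQ, hL⟩ := h
  set G : W → (Option σ → ℤ) → W := fun w m => ser (l₁.map (Prod.map some id) ++
    (none, a) :: (some t, b) :: l₂.map (Prod.map some id)) m w with hG
  set H : W → (Option σ → ℤ) → W := fun w m => ser l₁ (m ∘ some)
    (coeffEnd (y (m none)) (m (some t)) (ser l₂ (m ∘ some) w)) with hH
  have hne : (none : Option σ) ≠ some t := by simp
  have hcongr : ∀ l : List (σ × FieldSpace W), t ∉ l.map Prod.fst → ∀ (m : Option σ → ℤ) i k,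
      ser l (Function.update (Function.update m none i) (some t) k ∘ some) = ser l (m ∘ some) := by
    intro l hl m i k
    refine ser_congr fun s hs => ?_
    have : s ≠ t := fun e => hl (e ▸ hs)
    simp [this]
  -- With the other exponents frozen, the fields to the right produce a vector and those to the left
  -- act by a linear map, so the relation for the pair `a, b` carries over.
  have hlift : ∀ w, LiftRel none (some t) (IsT2 α) (G w) (H w) := by
    intro w m
    convert (hy (ser l₂ (m ∘ some) w)).comp (ser l₁ (m ∘ some)) using 1
    · ext n
      simp only [slice, hG, ser_append, ser_cons, ser_map, Module.End.mul_apply, hcongr _ h₁,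
        hcongr _ h₂, prodSeries_two]
      simp
    · ext n
      simp only [slice, hH, hcongr _ h₁, hcongr _ h₂]
      simp
  have heq : ∀ w, act (tau (α : ℂ) none (some t) Q) (H w) =
      substVar α none (some t) (act Q (G w)) :=
    fun w => (hlift w).eq_substVar hne fun m => (hL w).slice hne m
  set P := optionEquivLeft ℂ σ (tau (α : ℂ) none (some t) Q) with hP
  have hP0 : P ≠ 0 := optionEquivLeft_tau_ne_zero _ t (ne_zero_of_mem_pairMonoid hQ)
  -- With the modes starting at `K`, the induction reaches index `j` once the exponent exceeds `j -
  -- K`.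
  refine ⟨P.trailingCoeff ^ (j - K + 1).toNat, pow_mem (trailingCoeff_tau_mem _ t hQ) _,
    fun w => ?_⟩
  have hcoef : (fun m => ser (l₁ ++ (t, y j) :: l₂) m w) = optCoeff (H w) j := by
    ext m
    simp only [ser_append, ser_cons, Module.End.mul_apply, optCoeff, hH, Function.comp_def,
      Option.elim]
  rw [hcoef]
  refine laur_trailingCoeff_pow hP0 (K := K) (fun n hn => ?_) (fun n => ?_) _ j (by omega)
  · ext m
    simp only [optCoeff, hH, Option.elim, hK n hn, coeffEnd_zero, LinearMap.zero_apply, map_zero]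
    rfl
  · rw [← optCoeff_act, heq]
    obtain ⟨N, hN⟩ := (hL w).substVar_coeff α hne n
    exact ⟨N, fun m hm i => hN _ rfl hm (some i) (by simp)⟩

/-- The series is supported where the new exponent is zero, so the old polynomial still works. -/
lemma LabelledQC.insert_id [DecidableEq σ] {l₁ l₂ : List (σ × FieldSpace W)}
    (h : LabelledQC (l₁ ++ l₂)) :
    LabelledQC (l₁.map (Prod.map some id) ++
      (none, idField W) :: l₂.map (Prod.map some id)) := by
  obtain ⟨Q, hQ, hL⟩ := h
  refine ⟨rename some Q, rename_mem_pairMonoid (Option.some_injective _) hQ, fun w => ?_⟩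
  let T : ((σ → ℤ) → W) →ₗ[ℂ] ((Option σ → ℤ) → W) :=
    { toFun := fun F m => if m none = 0 then F (m ∘ some) else 0
      map_add' := fun F F' => by ext m; simp only [Pi.add_apply]; split_ifs <;> simp
      map_smul' := fun c F => by ext m; simp only [Pi.smul_apply]; split_ifs <;> simp }
  have hT := map_act_rename some T (fun s F => by
    ext m
    rw [act_X]
    change (if m none = 0 then act (X s) F (m ∘ some) else 0) =
      if (m - Pi.single (some s) 1 : Option σ → ℤ) none = 0
        then F ((m - Pi.single (some s) 1) ∘ some) else 0
    rw [act_X]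
    have e : (m - Pi.single (some s) 1) ∘ some = m ∘ some - Pi.single s 1 := by
      ext u
      by_cases hu : u = s
      · subst hu; simp
      · simp [hu]
    rw [e]
    simp) Q fun m => ser (l₁ ++ l₂) m w
  have e1 : (fun m => ser (l₁.map (Prod.map some id) ++
      (none, idField W) :: l₂.map (Prod.map some id)) m w) = T fun m => ser (l₁ ++ l₂) m w := by
    ext m
    simp only [ser_append, ser_cons, ser_map, Module.End.mul_apply, coeffEnd_id]
    change _ = if m none = 0 then _ else 0
    split_ifs <;> simp
  rw [e1, ← hT]
  obtain ⟨N, hN⟩ := hL w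
  refine ⟨min N 0, fun m hm i => ?_⟩
  change (if m none = 0 then _ else 0) ≠ 0 at hm
  split_ifs at hm with h0
  · cases i with
    | none => exact (min_le_right _ _).trans h0.ge
    | some i => exact (min_le_left _ _).trans (hN _ hm i)
  · exact absurd rfl hm

lemma LabelledQC.add {l₁ l₂ : List (σ × FieldSpace W)} {t : σ} {a b : FieldSpace W}
    (ha : LabelledQC (l₁ ++ (t, a) :: l₂)) (hb : LabelledQC (l₁ ++ (t, b) :: l₂)) :
    LabelledQC (l₁ ++ (t, a + b) :: l₂) := by
  obtain ⟨P, hP, ha⟩ := ha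
  obtain ⟨Q, hQ, hb⟩ := hb
  refine ⟨P * Q, mul_mem hP hQ, fun w => ?_⟩
  have : (fun m => ser (l₁ ++ (t, a + b) :: l₂) m w) =
      (fun m => ser (l₁ ++ (t, a) :: l₂) m w) + fun m => ser (l₁ ++ (t, b) :: l₂) m w := by
    ext m
    simp [ser_append, ser_cons, coeffEnd_add]
  rw [this, map_add]
  refine Laur.add ?_ ?_
  · rw [mul_comm, act_mul]; exact (ha w).act _
  · rw [act_mul]; exact (hb w).act _

lemma LabelledQC.smul {l₁ l₂ : List (σ × FieldSpace W)} {t : σ} {a : FieldSpace W}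
    (ha : LabelledQC (l₁ ++ (t, a) :: l₂)) (c : ℂ) : LabelledQC (l₁ ++ (t, c • a) :: l₂) := by
  obtain ⟨P, hP, ha⟩ := ha
  refine ⟨P, hP, fun w => ?_⟩
  have : (fun m => ser (l₁ ++ (t, c • a) :: l₂) m w) =
      c • fun m => ser (l₁ ++ (t, a) :: l₂) m w := by
    ext m
    simp [ser_append, ser_cons, coeffEnd_smul]
  rw [this, map_smul]
  exact (ha w).smul c

end Replace

/-! ### Adjoinable fields and maximality. -/

section Adjoin

variable {W : Type*} [AddCommGroup W] [Module ℂ W] {V : Submodule ℂ (FieldSpace W)}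

lemma map_snd_map {σ τ : Type*} (f : σ → τ) (l : List (σ × FieldSpace W)) :
    (l.map (Prod.map f id)).map Prod.snd = l.map Prod.snd := by
  simp [Function.comp_def]

lemma Valid.insert_none {σ : Type*} {l₁ l₂ : List (σ × FieldSpace W)} (hv : Valid (l₁ ++ l₂))
    (c : FieldSpace W) :
    Valid (l₁.map (Prod.map some id) ++ (none, c) :: l₂.map (Prod.map some id)) := by
  have e1 : ∀ l : List (σ × FieldSpace W),
      (l.map (Prod.map some id)).map Prod.fst = (l.map Prod.fst).map some := fun l => by
    simp [Function.comp_def]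
  constructor
  · simp only [List.map_append, List.map_cons, e1]
    have h3 := (hv.1.map (Option.some_injective _))
    simp only [List.map_append] at h3
    rw [List.nodup_middle, List.nodup_cons]
    exact ⟨by simp, h3⟩
  · intro s
    simp only [List.map_append, List.map_cons, e1]
    cases s with
    | none => simp
    | some s =>
      have := hv.2 s
      simp only [List.map_append, List.mem_append] at this
      simp only [List.mem_append, List.mem_cons, reduceCtorEq, false_or,
        List.mem_map_of_injective (Option.some_injective _)]
      exact this

lemma ListQC.mode {α : ℂˣ} {a b : FieldSpace W} {y : ℤ → FieldSpace W}
    (hy : IsY α a b y) {K : ℤ} (hK : ∀ j < K, y j = 0) {L₁ L₂ : List (FieldSpace W)}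
    (h : ListQC (L₁ ++ a :: b :: L₂)) (j : ℤ) : ListQC (L₁ ++ y j :: L₂) := by
  obtain ⟨r, l₁, l₂, t, hv, rfl, rfl⟩ := exists_valid L₁ L₂ (y j)
  have hnd := hv.1
  simp only [List.map_append, List.map_cons, List.nodup_append, List.nodup_cons] at hnd
  have h₁ : t ∉ l₁.map Prod.fst := fun ht => hnd.2.2 t ht t (by simp) rfl
  have h₂ : t ∉ l₂.map Prod.fst := hnd.2.1.1
  have e := hv.listQC_iff
  simp only [List.map_append, List.map_cons] at e
  rw [e]
  refine LabelledQC.mode hy hK h₁ h₂ ?_ j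
  have hv' : Valid (l₁.map (Prod.map some id) ++
      (none, a) :: (some t, b) :: l₂.map (Prod.map some id)) :=
    (hv.replace (c' := b)).insert_none a
  rw [← hv'.listQC_iff]
  simp only [List.map_append, List.map_cons, map_snd_map]
  exact h

lemma ListQC.insert_id {L₁ L₂ : List (FieldSpace W)} (h : ListQC (L₁ ++ L₂)) :
    ListQC (L₁ ++ idField W :: L₂) := by
  obtain ⟨r, l₁, l₂, hv, rfl, rfl⟩ := exists_valid_append L₁ L₂
  have h1 := hv.listQC_iff
  have h2 := (hv.insert_none (idField W)).listQC_iff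
  simp only [List.map_append, List.map_cons, map_snd_map] at h1 h2
  exact h2.2 (h1.1 h).insert_id

lemma ListQC.add {L₁ L₂ : List (FieldSpace W)} {a b : FieldSpace W}
    (ha : ListQC (L₁ ++ a :: L₂)) (hb : ListQC (L₁ ++ b :: L₂)) :
    ListQC (L₁ ++ (a + b) :: L₂) := by
  obtain ⟨r, l₁, l₂, t, hv, rfl, rfl⟩ := exists_valid L₁ L₂ (a + b)
  have h1 := hv.listQC_iff
  have h2 := (hv.replace (c' := a)).listQC_iff
  have h3 := (hv.replace (c' := b)).listQC_iff
  simp only [List.map_append, List.map_cons] at h1 h2 h3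
  exact h1.2 ((h2.1 ha).add (h3.1 hb))

lemma ListQC.smul {L₁ L₂ : List (FieldSpace W)} {a : FieldSpace W}
    (ha : ListQC (L₁ ++ a :: L₂)) (c : ℂ) : ListQC (L₁ ++ (c • a) :: L₂) := by
  obtain ⟨r, l₁, l₂, t, hv, rfl, rfl⟩ := exists_valid L₁ L₂ (c • a)
  have h1 := hv.listQC_iff
  have h2 := (hv.replace (c' := a)).listQC_iff
  simp only [List.map_append, List.map_cons] at h1 h2
  exact h1.2 ((h2.1 ha).smul c)

variable (V) in
/-- `c` can replace arbitrary sequences in `V` in quasi compatible sequences. -/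
def Adjoinable (c : FieldSpace W) : Prop :=
  ∀ L₁ L₂ : List (FieldSpace W), (∀ L : List (FieldSpace W), (∀ a ∈ L, a ∈ V) →
    ListQC (L₁ ++ L ++ L₂)) → ListQC (L₁ ++ c :: L₂)

lemma adjoinable_of_mem {c : FieldSpace W} (hc : c ∈ V) : Adjoinable V c := by
  intro L₁ L₂ h
  have := h [c] (by simpa using hc)
  simpa using this

lemma adjoinable_id : Adjoinable V (idField W) := by
  intro L₁ L₂ h
  have := h [] (by simp)
  rw [List.append_nil] at this
  exact this.insert_id

lemma Adjoinable.add {a b : FieldSpace W} (ha : Adjoinable V a) (hb : Adjoinable V b) :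
    Adjoinable V (a + b) :=
  fun L₁ L₂ h => (ha L₁ L₂ h).add (hb L₁ L₂ h)

lemma Adjoinable.smul {a : FieldSpace W} (ha : Adjoinable V a) (c : ℂ) : Adjoinable V (c • a) :=
  fun L₁ L₂ h => (ha L₁ L₂ h).smul c

/-- The contexts in `Adjoinable` are arbitrary lists, not lists from `V`; hence `a` can be inserted
next to `b`, then `b` next to elements of `V`, before the pair is replaced by a mode. -/
lemma Adjoinable.mode {α : ℂˣ} {a b : FieldSpace W} {y : ℤ → FieldSpace W} (ha : Adjoinable V a)
    (hb : Adjoinable V b) (hy : IsY α a b y) {K : ℤ} (hK : ∀ j < K, y j = 0) (j : ℤ) :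
    Adjoinable V (y j) := by
  intro L₁ L₂ h
  refine ListQC.mode hy hK (ha L₁ (b :: L₂) fun L hL => hb (L₁ ++ L) L₂ fun L' hL' => ?_) j
  have := h (L ++ L') fun c hc => (List.mem_append.1 hc).elim (hL c) (hL' c)
  simpa using this

/-- The prefix from `V` absorbs the sequences that stand in for the first entry `c`, which reduces
the claim to the shorter list. -/
lemma listQC_of_adjoinable (hV : QuasiCompatible (V : Set (FieldSpace W)))
    (L : List (FieldSpace W)) (hL : ∀ c ∈ L, Adjoinable V c) :
    ∀ L' : List (FieldSpace W), (∀ a ∈ L', a ∈ V) → ListQC (L' ++ L) := by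
  induction L with
  | nil =>
    intro L' h
    rw [List.append_nil]
    exact quasiCompatible_iff.1 hV L' h
  | cons c L ih =>
    intro L' h
    refine hL c (by simp) L' L fun L'' h'' => ?_
    exact ih (fun c hc => hL c (by simp [hc])) _
      fun c hc => (List.mem_append.1 hc).elim (h c) (h'' c)

lemma mem_of_adjoinable (hV : Maximal (fun U : Submodule ℂ (FieldSpace W) =>
      QuasiCompatible (U : Set (FieldSpace W))) V) {c : FieldSpace W} (hc : Adjoinable V c) :
    c ∈ V := by
  -- The adjoinable fields form a quasi compatible subspace that contains `V`, so maximality forces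
  -- it into `V`.
  let U : Submodule ℂ (FieldSpace W) :=
    { carrier := {c | Adjoinable V c}
      add_mem' := fun ha hb => ha.add hb
      zero_mem' := adjoinable_of_mem V.zero_mem
      smul_mem' := fun c _ ha => ha.smul c }
  have hU : QuasiCompatible (U : Set (FieldSpace W)) :=
    quasiCompatible_iff.2 fun L hL => listQC_of_adjoinable hV.1 L hL [] (by simp)
  exact hV.2 hU (fun _ => adjoinable_of_mem) hc

lemma exists_regularizes (hV : QuasiCompatible (V : Set (FieldSpace W))) {a b : FieldSpace W}
    (ha : a ∈ V) (hb : b ∈ V) : ∃ p, Regularizes p a b := by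
  obtain ⟨p, hp, h⟩ := hV 2 ![a, b] fun i => by fin_cases i <;> assumption
  have e : pairProd 2 p = p := by
    have : (Finset.univ.filter fun ij : Fin 2 × Fin 2 => ij.1 < ij.2) = {(0, 1)} := by decide
    rw [pairProd, this, Finset.prod_singleton]
    have e1 : ![(0 : Fin 2), 1] = id := by ext u; fin_cases u <;> rfl
    rw [e1, rename_id_apply]
  refine ⟨p, hp, fun w => ?_⟩
  have := h w
  rwa [e] at this

/-- The vertex operators `Y_𝓔^{(α)}` preserve a maximal quasi compatible subspace. -/
lemma exists_isY_mem (hV : Maximal (fun U : Submodule ℂ (FieldSpace W) =>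
      QuasiCompatible (U : Set (FieldSpace W))) V) (α : ℂˣ) {a b : FieldSpace W} (ha : a ∈ V)
    (hb : b ∈ V) : ∃ y, IsY α a b y ∧ (∀ j, y j ∈ V) ∧
      (∀ n : ℤ, toSeries (y (-n - 1)) = modeProd α n a b) ∧ ∃ N : ℤ, ∀ j < N, y j = 0 := by
  obtain ⟨y, h1, h2, N, hN⟩ := exists_isY α (exists_regularizes hV.1 ha hb)
  exact ⟨y, h1, fun j => mem_of_adjoinable hV
    ((adjoinable_of_mem ha).mode (adjoinable_of_mem hb) h1 hN j), h2, N, hN⟩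

end Adjoin

/-! ### The substitution `x₀ + x₂` expanded in nonnegative powers of `x₂`. -/

section SubstAdd

variable {U U' : Type*} [AddCommGroup U] [Module ℂ U] [AddCommGroup U'] [Module ℂ U']

/-- The powers of the second variable are bounded below. -/
def BddSnd (F : (Fin 2 → ℤ) → U) : Prop := ∃ N : ℤ, ∀ m, F m ≠ 0 → N ≤ m 1

lemma BddSnd.act {F : (Fin 2 → ℤ) → U} (hF : BddSnd F) (P : MvPolynomial (Fin 2) ℂ) :
    BddSnd (act P F) := by
  obtain ⟨N, hN⟩ := hF
  refine ⟨N, fun m hm => ?_⟩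
  obtain ⟨d, -, hd⟩ := exists_act_ne_zero hm
  have := hN _ hd
  simp at this
  omega

lemma substAdd_eq_sum {F : (Fin 2 → ℤ) → U} {N : ℤ} (hN : ∀ m, F m ≠ 0 → N ≤ m 1)
    (m : Fin 2 → ℤ) {K : ℕ} (hK : m 1 - N < K) :
    substAdd F m = ∑ i ∈ Finset.range K, Ring.choose (m 0 + i) i • F ![m 0 + i, m 1 - i] := by
  unfold substAdd
  refine finsum_eq_sum_of_support_subset _ fun i hi => ?_
  have := hN _ (right_ne_zero_of_smul hi)
  simp at this ⊢
  omega

lemma substAdd_X_zero {F : (Fin 2 → ℤ) → U} (hF : BddSnd F) :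
    substAdd (act (X 0) F) = act (C 1 * X 1 + X 0) (substAdd F) := by
  obtain ⟨N, hN⟩ := hF
  ext m
  obtain ⟨K, hK⟩ : ∃ K : ℕ, m 1 - N < K := ⟨(m 1 - N + 1).toNat, by omega⟩
  have hN' : ∀ m, act (X 0) F m ≠ 0 → N ≤ m 1 := fun m hm => by
    rw [act_X] at hm
    simpa using hN _ hm
  -- Two of the sums are taken one term longer: their terms at `0` agree, and the rest match the
  -- third sum by Pascal's rule.
  rw [substAdd_eq_sum hN' m (K := K + 1) (by push_cast; omega), act_add, act_mul, act_C, one_smul,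
    Pi.add_apply, act_X, act_X, substAdd_eq_sum hN _ (K := K) (by simp; omega),
    substAdd_eq_sum hN _ (K := K + 1) (by simp; omega), Finset.sum_range_succ',
    Finset.sum_range_succ', ← add_assoc, ← Finset.sum_add_distrib]
  congr 1
  · refine Finset.sum_congr rfl fun i _ => ?_
    have h1 : m 0 + ((i + 1 : ℕ) : ℤ) = (m 0 + i) + 1 := by push_cast; ring
    have h2 : (m - Pi.single 0 1 : Fin 2 → ℤ) 0 + ((i + 1 : ℕ) : ℤ) = m 0 + i := by
      simp
    have h3 : (m - Pi.single 0 1 : Fin 2 → ℤ) 1 - ((i + 1 : ℕ) : ℤ) =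
        (m - Pi.single 1 1 : Fin 2 → ℤ) 1 - i := by
      simp; ring
    have h4 : (m - Pi.single 1 1 : Fin 2 → ℤ) 0 + i = m 0 + i := by simp
    rw [h1, h2, h3, h4, Ring.choose_succ_succ, ← add_smul, act_X]
    congr 2
    ext u; fin_cases u <;> simp
    ring
  · rw [act_X]
    simp only [Nat.cast_zero, Ring.choose_zero_right, add_zero, sub_zero, one_smul]
    congr 1
    ext u; fin_cases u <;> simp

lemma substAdd_X_one (F : (Fin 2 → ℤ) → U) :
    substAdd (act (X 1) F) = act (X 1) (substAdd F) := by
  ext m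
  rw [act_X]
  unfold substAdd
  refine finsum_congr fun i => ?_
  rw [act_X]
  congr 2
  · simp
  · ext u; fin_cases u <;> simp
    ring

lemma BddSnd.finite {F : (Fin 2 → ℤ) → U} (hF : BddSnd F) (m : Fin 2 → ℤ) :
    (Function.support fun i : ℕ => Ring.choose (m 0 + i) i • F ![m 0 + i, m 1 - i]).Finite := by
  obtain ⟨N, hN⟩ := hF
  refine (Set.finite_Iic (m 1 - N).toNat).subset fun i hi => ?_
  have := hN _ (right_ne_zero_of_smul hi)
  simp at this ⊢
  omega

lemma substAdd_comp {F : (Fin 2 → ℤ) → U} (hF : BddSnd F) (g : U →ₗ[ℂ] U') :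
    substAdd (fun m => g (F m)) = fun m => g (substAdd F m) := by
  ext m
  unfold substAdd
  exact ((g.toAddMonoidHom.map_finsum (hF.finite m)).trans
    (finsum_congr fun i => map_zsmul g _ _)).symm

lemma substAdd_act {F : (Fin 2 → ℤ) → U} (hF : BddSnd F) (P : MvPolynomial (Fin 2) ℂ) :
    substAdd (act P F) = act (tau 1 0 1 P) (substAdd F) := by
  induction P using MvPolynomial.induction_on generalizing F with
  | C a =>
    rw [tau_C, act_C, act_C]
    exact substAdd_comp hF (a • LinearMap.id)
  | add P Q hP hQ =>
    rw [act_add, map_add (tau 1 0 1), act_add, ← hP hF, ← hQ hF]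
    ext m
    refine Eq.trans ?_ (finsum_add_distrib ((hF.act P).finite m) ((hF.act Q).finite m))
    exact finsum_congr fun i => smul_add _ _ _
  | mul_X P s hP =>
    rw [act_mul, hP (hF.act _), map_mul (tau 1 0 1), act_mul]
    congr 1
    fin_cases s
    · exact (substAdd_X_zero hF).trans (by simp)
    · exact (substAdd_X_one F).trans (by simp [tau_X_of_ne])

/-- `H = F(x₀ + x₁, x₁)` for a series `F` whose powers of `x₁` are bounded below. -/
def IsSubstAdd (F H : (Fin 2 → ℤ) → U) : Prop := BddSnd F ∧ H = substAdd F

/-- On polynomials the substitution does not see the direction of expansion, so the same `tau`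
occurs as for `IsT2`. -/
lemma semilin_isSubstAdd : Semilin 1 (IsSubstAdd (U := U)) := by
  refine ⟨?_, ?_, ?_⟩
  · rintro F _ F' _ ⟨⟨N, hN⟩, rfl⟩ ⟨⟨N', hN'⟩, rfl⟩
    refine ⟨⟨min N N', fun m hm => ?_⟩, ?_⟩
    · by_cases h : F m = 0
      · have : F' m ≠ 0 := by simpa [h] using hm
        exact (min_le_right _ _).trans (hN' m this)
      · exact (min_le_left _ _).trans (hN m h)
    · ext m
      refine Eq.trans ?_ (finsum_congr fun i => (smul_add _ _ _).symm)
      exact (finsum_add_distrib (BddSnd.finite ⟨N, hN⟩ m) (BddSnd.finite ⟨N', hN'⟩ m)).symm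
  · rintro F _ a ⟨h, rfl⟩
    refine ⟨by rw [← act_C]; exact h.act _, ?_⟩
    rw [← act_C, ← act_C, substAdd_act h, tau_C]
  · rintro F _ P ⟨h, rfl⟩
    exact ⟨h.act P, (substAdd_act h P).symm⟩

lemma finsum_nat_eq_int (f : ℤ → U) (h : ∀ i < 0, f i = 0) : ∑ᶠ i : ℕ, f i = ∑ᶠ i : ℤ, f i := by
  rw [← finsum_mem_range (g := ((↑) : ℕ → ℤ)) Nat.cast_injective, finsum_mem_def]
  refine finsum_congr fun i => ?_
  by_cases hi : 0 ≤ i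
  · rw [Set.indicator_of_mem]
    exact ⟨i.toNat, by simp [hi]⟩
  · rw [h i (by omega), Set.indicator_apply_eq_zero]
    exact fun _ => h i (by omega)

/-- Symmetry of binomial coefficients; it needs `0 ≤ i`, which is why the two expansions agree only
without negative powers. -/
lemma choose_symm_int {i j : ℤ} (hi : 0 ≤ i) (p : ℕ) (hp : i = j + p) :
    Ring.choose i p = if 0 ≤ j then Ring.choose i j.toNat else 0 := by
  obtain ⟨n, rfl⟩ := Int.eq_ofNat_of_zero_le hi
  rw [Ring.choose_natCast]
  split_ifs with h
  · obtain ⟨k, rfl⟩ := Int.eq_ofNat_of_zero_le h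
    have hn : n = k + p := by exact_mod_cast hp
    subst hn
    rw [Ring.choose_natCast]
    norm_cast
    rw [Nat.choose_symm_add]
  · rw [Nat.choose_eq_zero_of_lt (by omega)]
    simp

/-- For series without negative powers of the first variable the two expansions of
`F(x₀ + x₁, x₁)` agree. -/
lemma substAdd_eq_sub2 {F : (Fin 2 → ℤ) → U} (hF : ∀ m, F m ≠ 0 → 0 ≤ m 0) :
    substAdd F = sub2 1 F := by
  ext m
  have h1 : substAdd F m = ∑ᶠ p : ℕ, subCoeff 1 (m 0) (m 0 + (p : ℤ)) •
      F ![m 0 + (p : ℤ), m 1 - (p : ℤ)] := by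
    refine finsum_congr fun p => ?_
    by_cases h : F ![m 0 + (p : ℤ), m 1 - (p : ℤ)] = 0
    · simp [h]
    · have h0 : 0 ≤ m 0 + (p : ℤ) := by simpa using hF _ h
      rw [choose_symm_int h0 p rfl, ← Int.cast_smul_eq_zsmul ℂ]
      congr 1
      unfold subCoeff
      split_ifs <;> simp
  rw [h1, finsum_nat_eq_int (fun p : ℤ => subCoeff 1 (m 0) (m 0 + p) • F ![m 0 + p, m 1 - p]),
    sub2_apply]
  · conv_rhs => rw [← finsum_comp_equiv (Equiv.addLeft (m 0))]
    refine finsum_congr fun p => ?_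
    simp
  · intro p hp
    by_cases h : F ![m 0 + p, m 1 - p] = 0
    · rw [h, smul_zero]
    · have h0 : 0 ≤ m 0 + p := by simpa using hF _ h
      unfold subCoeff
      split_ifs with h2
      · obtain ⟨n, hn⟩ := Int.eq_ofNat_of_zero_le h0
        rw [hn, Ring.choose_natCast, Nat.choose_eq_zero_of_lt (by omega)]
        simp
      · rw [zero_smul]

end SubstAdd

/-! ### Associativity of iterated substitutions. -/

section Binomial

variable {U : Type*} [AddCommGroup U] [Module ℂ U]

/-- The substitution `x_s ↦ x_s + x_t`, expanded in nonnegative powers of `x_t`. -/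
def addVar {σ : Type*} [DecidableEq σ] (s t : σ) (F : (σ → ℤ) → U) : (σ → ℤ) → U :=
  fun m => substAdd (slice s t m F) ![m s, m t]

lemma subCoeff_one (j i : ℤ) :
    subCoeff 1 j i = if 0 ≤ j then ((Ring.choose i j.toNat : ℤ) : ℂ) else 0 := by
  simp [subCoeff]

/-- Since `C(j+p, p) C(i, j+p) = C(i, j) C(i-j, p)`, this is the Vandermonde identity for `(i - j) +
n`. For `j < 0` both sides vanish. -/
lemma sum_choose_mul (i n j k : ℤ) (hk : 0 ≤ k) :
    ∑ p ∈ Finset.range (k.toNat + 1), ((Ring.choose (j + p) p : ℤ) : ℂ) *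
      (subCoeff 1 (j + p) i * subCoeff 1 (k - p) n) =
    subCoeff 1 j i * subCoeff 1 k (n + i - j) := by
  obtain ⟨k, rfl⟩ := Int.eq_ofNat_of_zero_le hk
  simp only [Int.toNat_natCast, subCoeff_one]
  by_cases hj : 0 ≤ j
  · obtain ⟨j, rfl⟩ := Int.eq_ofNat_of_zero_le hj
    have h1 : n + i - (j : ℤ) = (i - j) + n := by ring
    simp only [Nat.cast_nonneg, if_true, Int.toNat_natCast]
    rw [h1, Ring.add_choose_eq k (Commute.all _ _),
      Finset.Nat.sum_antidiagonal_eq_sum_range_succ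
        (fun p q => Ring.choose (i - (j : ℤ)) p * Ring.choose n q)]
    push_cast
    rw [Finset.mul_sum]
    refine Finset.sum_congr rfl fun p hp => ?_
    have hp' : p ≤ k := by simpa [Nat.lt_succ_iff] using hp
    have h2 : (0 : ℤ) ≤ (j : ℤ) + p := by omega
    have h3 : (0 : ℤ) ≤ (k : ℤ) - p := by omega
    have h4 : ((j : ℤ) + p).toNat = j + p := by omega
    have h5 : ((k : ℤ) - p).toNat = k - p := by omega
    rw [if_pos h2, if_pos h3, h4, h5]
    have h6 := Ring.choose_smul_choose i (n := j + p) (k := j) (by omega)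
    rw [Nat.add_sub_cancel_left, nsmul_eq_mul] at h6
    have h7 : Ring.choose ((j : ℤ) + p) p = ((j + p).choose j : ℤ) := by
      have : ((j : ℤ) + p) = ((j + p : ℕ) : ℤ) := by push_cast; rfl
      rw [this, Ring.choose_natCast, Nat.choose_symm_add]
    rw [h7, ← mul_assoc, ← mul_assoc]
    congr 1
    exact_mod_cast h6
  · rw [if_neg hj, zero_mul]
    refine Finset.sum_eq_zero fun p _ => ?_
    split_ifs with h1 h2
    · obtain ⟨n, hn⟩ := Int.eq_ofNat_of_zero_le h1
      rw [hn, Ring.choose_natCast, Nat.choose_eq_zero_of_lt (by omega)]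
      simp
    all_goals simp

lemma substVar_zero_one (F : (Fin 3 → ℤ) → U) (a b c : ℤ) : substVar 1 0 1 F ![a, b, c] =
    ∑ᶠ i : ℤ, subCoeff 1 a i • F ![i, b - (i - a), c] := by
  rw [substVar, sub2_apply]
  refine finsum_congr fun i => ?_
  simp only [slice]
  congr 2
  ext u; fin_cases u <;> simp

lemma substVar_zero_two (F : (Fin 3 → ℤ) → U) (a b c : ℤ) : substVar 1 0 2 F ![a, b, c] =
    ∑ᶠ i : ℤ, subCoeff 1 a i • F ![i, b, c - (i - a)] := by
  rw [substVar, sub2_apply]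
  refine finsum_congr fun i => ?_
  simp only [slice]
  congr 2
  ext u; fin_cases u <;> simp

lemma substVar_one_two (F : (Fin 3 → ℤ) → U) (a b c : ℤ) : substVar 1 1 2 F ![a, b, c] =
    ∑ᶠ i : ℤ, subCoeff 1 b i • F ![a, i, c - (i - b)] := by
  rw [substVar, sub2_apply]
  refine finsum_congr fun i => ?_
  simp only [slice]
  congr 2
  ext u; fin_cases u <;> simp

lemma addVar_zero_one (F : (Fin 3 → ℤ) → U) (a b c : ℤ) : addVar 0 1 F ![a, b, c] =
    ∑ᶠ i : ℕ, Ring.choose (a + i) i • F ![a + i, b - i, c] := by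
  rw [addVar, substAdd]
  refine finsum_congr fun i => ?_
  simp only [slice]
  congr 2
  ext u; fin_cases u <;> simp

/-- `F(x + (x₀ + x₂), x + x₂, x) = F((x + x₂) + x₀, x + x₂, x)`. -/
lemma addVar_substVar {F : (Fin 3 → ℤ) → U} (hF : Laur F) :
    addVar 0 1 (substVar 1 0 2 (substVar 1 1 2 F)) = substVar 1 1 2 (substVar 1 0 1 F) := by
  ext m
  obtain ⟨a, b, c, rfl⟩ : ∃ a b c, m = ![a, b, c] :=
    ⟨m 0, m 1, m 2, by ext u; fin_cases u <;> rfl⟩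
  obtain ⟨N, hN⟩ := hF
  -- The substitutions preserve total degree, so both sides are sums over the coefficients of `F` of
  -- degree `a + b + c`, of which finitely many are nonzero.
  set g : ℤ × ℤ → U := fun x => F ![x.1, x.2, a + b + c - x.1 - x.2] with hg
  set s : Finset (ℤ × ℤ) :=
    Finset.Icc N (a + b + c - 2 * N) ×ˢ Finset.Icc N (a + b + c - 2 * N) with hs
  have hgs : ∀ x, g x ≠ 0 → x ∈ s := by
    intro x hx
    have h := hN _ hx
    have h0 := h 0
    have h1 := h 1
    have h2 := h 2
    simp at h0 h1 h2
    simp only [hs, Finset.mem_product, Finset.mem_Icc]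
    omega
  have hsupp : ∀ f : ℤ × ℤ → ℂ, (Function.support fun x => f x • g x) ⊆ s :=
    fun f x hx => hgs x (right_ne_zero_of_smul hx)
  have hfin : ∀ f : ℤ × ℤ → ℂ, (Function.support fun x => f x • g x).Finite :=
    fun f => s.finite_toSet.subset (hsupp f)
  have hL : ∀ p : ℤ, substVar 1 0 2 (substVar 1 1 2 F) ![a + p, b - p, c] =
      ∑ x ∈ s, (subCoeff 1 (a + p) x.1 * subCoeff 1 (b - p) x.2) • g x := by
    intro p
    rw [← finsum_eq_sum_of_support_subset _ (hsupp _), finsum_curry _ (hfin _), substVar_zero_two]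
    refine finsum_congr fun i => ?_
    rw [substVar_one_two, smul_finsum]
    refine finsum_congr fun n => ?_
    rw [smul_smul]
    congr 2
    ext u; fin_cases u <;> simp
    ring
  have hR : substVar 1 1 2 (substVar 1 0 1 F) ![a, b, c] =
      ∑ x ∈ s, (subCoeff 1 a x.1 * subCoeff 1 b (x.2 + x.1 - a)) • g x := by
    let e : ℤ × ℤ ≃ ℤ × ℤ :=
      { toFun := fun x => (x.2, x.1 - x.2 + a)
        invFun := fun x => (x.2 + x.1 - a, x.1)
        left_inv := fun x => by ext <;> simp <;> ring
        right_inv := fun x => by ext <;> simp <;> ring }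
    rw [← finsum_eq_sum_of_support_subset _ (hsupp _), ← finsum_comp_equiv e, finsum_curry,
      substVar_one_two]
    · refine finsum_congr fun n => ?_
      rw [substVar_zero_one, smul_finsum]
      refine finsum_congr fun i => ?_
      rw [smul_smul, mul_comm]
      congr 2
      · simp only [e, Equiv.coe_fn_mk]
        congr 1
        ring
      · ext u; fin_cases u <;> simp [e]
        · ring
        · ring
    · exact (hfin fun x => subCoeff 1 a x.1 * subCoeff 1 b (x.2 + x.1 - a)).preimage e.injective.injOn
  rw [addVar_zero_one, hR]
  rcases lt_or_ge b 0 with hb | hb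
  · rw [finsum_eq_zero_of_forall_eq_zero]
    · refine (Finset.sum_eq_zero fun x _ => ?_).symm
      rw [subCoeff_one b, if_neg (by omega), mul_zero, zero_smul]
    · intro p
      rw [hL, Finset.sum_eq_zero, smul_zero]
      intro x _
      rw [subCoeff_one (b - p), if_neg (by omega), mul_zero, zero_smul]
  · rw [finsum_eq_sum_of_support_subset (s := Finset.range (b.toNat + 1))]
    · simp only [hL, Finset.smul_sum]
      rw [Finset.sum_comm]
      refine Finset.sum_congr rfl fun x _ => ?_
      rw [← sum_choose_mul x.1 x.2 a b hb, Finset.sum_smul]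
      refine Finset.sum_congr rfl fun p _ => ?_
      rw [← Int.cast_smul_eq_zsmul ℂ, smul_smul]
    · intro p hp
      by_contra hc
      refine hp ?_
      change Ring.choose (a + (p : ℤ)) p • substVar 1 0 2 (substVar 1 1 2 F) _ = 0
      rw [hL, Finset.sum_eq_zero, smul_zero]
      intro x _
      simp at hc
      rw [subCoeff_one (b - p), if_neg (by omega), mul_zero, zero_smul]

end Binomial

/-! ### Factoring the substituted regularizing polynomial. -/

section Factorization

lemma X_zero_dvd_of_aeval {g : MvPolynomial (Fin 2) ℂ}
    (h : aeval ![(0 : Polynomial ℂ), Polynomial.X] g = 0) : X 0 ∣ g := by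
  let I : Ideal (MvPolynomial (Fin 2) ℂ) := Ideal.span {X 0}
  let ι : Polynomial ℂ →ₐ[ℂ] MvPolynomial (Fin 2) ℂ := Polynomial.aeval (X 1)
  have h0 : Ideal.Quotient.mkₐ ℂ I (X 0) = 0 :=
    Ideal.Quotient.eq_zero_iff_mem.2 (Ideal.subset_span rfl)
  have e : ((Ideal.Quotient.mkₐ ℂ I).comp ι).comp (aeval ![(0 : Polynomial ℂ), Polynomial.X]) =
      Ideal.Quotient.mkₐ ℂ I := by
    ext u : 1
    fin_cases u
    · simpa using h0.symm
    · simp [ι]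
  have h1 : Ideal.Quotient.mkₐ ℂ I g = 0 := by
    rw [← e, AlgHom.comp_apply, h, map_zero]
  exact Ideal.mem_span_singleton.1 (Ideal.Quotient.eq_zero_iff_mem.1 h1)

lemma exists_X_pow_mul {f : MvPolynomial (Fin 2) ℂ} (hf : f ≠ 0) :
    ∃ (k : ℕ) (g : MvPolynomial (Fin 2) ℂ), f = X 0 ^ k * g ∧
      aeval ![(0 : Polynomial ℂ), Polynomial.X] g ≠ 0 := by
  have hfin : FiniteMultiplicity (X 0) f := by
    refine FiniteMultiplicity.of_prime_left ?_ hf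
    exact X_prime
  obtain ⟨g, h1, h2⟩ := hfin.exists_eq_pow_mul_and_not_dvd
  exact ⟨_, g, h1, fun h => h2 (X_zero_dvd_of_aeval h)⟩

lemma exists_mem_support_of_aeval {u : MvPolynomial (Fin 3) ℂ}
    (hu : aeval ![(0 : Polynomial ℂ), 0, Polynomial.X] u ≠ 0) :
    ∃ d ∈ u.support, d 0 = 0 ∧ d 1 = 0 := by
  by_contra! h
  refine hu ?_
  rw [aeval_def, eval₂_eq']
  refine Finset.sum_eq_zero fun d hd => ?_
  rw [Fin.prod_univ_three]
  by_cases h0 : d 0 = 0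
  · simp [h d hd h0]
  · simp [h0]

/-- The polynomial `∏_{i<j} p(x_i, x_j)` after the substitution
`x₀ ↦ x₀ + x₁ + x₂, x₁ ↦ x₁ + x₂`. -/
lemma exists_tau_pairProd {f : MvPolynomial (Fin 2) ℂ} (hf : f ≠ 0) :
    ∃ (k : ℕ) (u : MvPolynomial (Fin 3) ℂ), (∃ d ∈ u.support, d 0 = 0 ∧ d 1 = 0) ∧
      tau 1 1 2 (tau 1 0 1 (pairProd 3 f)) =
        X 0 ^ k * X 1 ^ k * (u * (X 0 + X 1) ^ k) := by
  obtain ⟨k, g, hg, hg0⟩ := exists_X_pow_mul (tau_ne_zero (σ := Fin 2) 1 (s := 0) (t := 1)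
    (by decide) hf)
  let η : MvPolynomial (Fin 3) ℂ → MvPolynomial (Fin 3) ℂ →
    MvPolynomial (Fin 2) ℂ →ₐ[ℂ] MvPolynomial (Fin 3) ℂ := fun a b => aeval ![a, b]
  have hη : ∀ a b, η a b (tau 1 0 1 f) = a ^ k * η a b g := fun a b => by
    rw [hg, map_mul, map_pow]; simp [η]
  have hr : ∀ i j : Fin 3, ∀ a b : MvPolynomial (Fin 3) ℂ,
      tau 1 1 2 (tau 1 0 1 (X i)) = b + a → tau 1 1 2 (tau 1 0 1 (X j)) = b →
      tau 1 1 2 (tau 1 0 1 (rename ![i, j] f)) = η a b (tau 1 0 1 f) := by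
    intro i j a b hi hj
    have : ((tau (1 : ℂ) (1 : Fin 3) 2).comp (tau 1 0 1)).comp (rename ![i, j]) =
        (η a b).comp (tau 1 0 1) := by
      ext v : 1
      fin_cases v
      · simpa [η] using hi
      · simpa [η, tau_X_of_ne] using hj
    exact DFunLike.congr_fun this f
  have h0 : tau (1 : ℂ) (1 : Fin 3) 2 (tau 1 0 1 (X 0)) = X 2 + X 1 + X 0 := by
    simp [tau_X_of_ne]
  have h1 : tau (1 : ℂ) (1 : Fin 3) 2 (tau 1 0 1 (X 1)) = X 2 + X 1 := by
    simp [tau_X_of_ne]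
  have h2 : tau (1 : ℂ) (1 : Fin 3) 2 (tau 1 0 1 (X 2)) = X 2 := by
    simp [tau_X_of_ne]
  have hP : pairProd 3 f = rename ![0, 1] f * rename ![0, 2] f * rename ![1, 2] f := by
    have : (Finset.univ.filter fun ij : Fin 3 × Fin 3 => ij.1 < ij.2) =
        {(0, 1), (0, 2), (1, 2)} := by decide
    rw [pairProd, this, Finset.prod_insert (by decide), Finset.prod_insert (by decide),
      Finset.prod_singleton, mul_assoc]
  -- The pairs `(0,1)`, `(0,2)`, `(1,2)` have differences `x₀`, `x₀ + x₁`, `x₁`, whose `k`-th powers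
  -- split off. At `x₀ = x₁ = 0` every remaining factor becomes `g(0, x₂) ≠ 0`.
  refine ⟨k, η (X 0) (X 1 + X 2) g * η (X 0 + X 1) (X 2) g * η (X 1) (X 2) g,
    exists_mem_support_of_aeval ?_, ?_⟩
  · have hε : ∀ a b : MvPolynomial (Fin 3) ℂ,
        aeval ![(0 : Polynomial ℂ), 0, Polynomial.X] a = 0 →
        aeval ![(0 : Polynomial ℂ), 0, Polynomial.X] b = Polynomial.X →
        aeval ![(0 : Polynomial ℂ), 0, Polynomial.X] (η a b g) ≠ 0 := by
      intro a b ha hb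
      have : (aeval ![(0 : Polynomial ℂ), 0, Polynomial.X]).comp (η a b) =
          aeval ![(0 : Polynomial ℂ), Polynomial.X] := by
        ext v : 1
        fin_cases v
        · simpa [η] using ha
        · simpa [η] using hb
      rw [← AlgHom.comp_apply, this]
      exact hg0
    rw [map_mul, map_mul]
    exact mul_ne_zero (mul_ne_zero (hε _ _ (by simp) (by simp)) (hε _ _ (by simp) (by simp)))
      (hε _ _ (by simp) (by simp))
  · rw [hP, map_mul, map_mul, map_mul, map_mul,
      hr 0 1 (X 0) (X 1 + X 2) (by rw [h0]; ring) (by rw [h1]; ring),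
      hr 0 2 (X 0 + X 1) (X 2) (by rw [h0]; ring) h2, hr 1 2 (X 1) (X 2) h1 h2, hη, hη, hη]
    ring

end Factorization

/-! ### Cancellation between different iterated Laurent spaces in three variables. -/

section Cancel

variable {U : Type*} [AddCommGroup U] [Module ℂ U]

/-- Series in `U((x₂))((x_t))((x_s))`. -/
def LexC (s t : Fin 3) (F : (Fin 3 → ℤ) → U) : Prop :=
  (∃ N : ℤ, ∀ m, F m ≠ 0 → N ≤ m s) ∧ (∀ i, ∃ N : ℤ, ∀ m, F m ≠ 0 → m s = i → N ≤ m t) ∧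
    ∀ i j, ∃ N : ℤ, ∀ m, F m ≠ 0 → m s = i → m t = j → N ≤ m 2

lemma LexC.add {s t : Fin 3} {F G : (Fin 3 → ℤ) → U} (hF : LexC s t F) (hG : LexC s t G) :
    LexC s t (F + G) := by
  have key : ∀ m, (F + G) m ≠ 0 → F m ≠ 0 ∨ G m ≠ 0 := fun m hm => by
    by_contra! h
    exact hm (by simp [h.1, h.2])
  refine ⟨?_, fun i => ?_, fun i j => ?_⟩
  · obtain ⟨N, hN⟩ := hF.1
    obtain ⟨M, hM⟩ := hG.1
    exact ⟨min N M, fun m hm => (key m hm).elim (fun h => (min_le_left _ _).trans (hN m h))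
      fun h => (min_le_right _ _).trans (hM m h)⟩
  · obtain ⟨N, hN⟩ := hF.2.1 i
    obtain ⟨M, hM⟩ := hG.2.1 i
    exact ⟨min N M, fun m hm hi => (key m hm).elim
      (fun h => (min_le_left _ _).trans (hN m h hi))
      fun h => (min_le_right _ _).trans (hM m h hi)⟩
  · obtain ⟨N, hN⟩ := hF.2.2 i j
    obtain ⟨M, hM⟩ := hG.2.2 i j
    exact ⟨min N M, fun m hm hi hj => (key m hm).elim
      (fun h => (min_le_left _ _).trans (hN m h hi hj))
      fun h => (min_le_right _ _).trans (hM m h hi hj)⟩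

lemma LexC.act {s t : Fin 3} {F : (Fin 3 → ℤ) → U} (hF : LexC s t F)
    (P : MvPolynomial (Fin 3) ℂ) : LexC s t (act P F) := by
  induction P using MvPolynomial.induction_on' with
  | add P Q hP hQ => rw [act_add]; exact hP.add hQ
  | monomial d c =>
    have key : ∀ m, NonlocalVA.act (monomial d c) F m ≠ 0 → F (m - expo d) ≠ 0 := fun m hm => by
      rw [act_monomial] at hm
      exact right_ne_zero_of_smul hm
    refine ⟨?_, fun i => ?_, fun i j => ?_⟩
    · obtain ⟨N, hN⟩ := hF.1
      refine ⟨N, fun m hm => ?_⟩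
      have := hN _ (key m hm)
      simp at this; omega
    · obtain ⟨N, hN⟩ := hF.2.1 (i - d s)
      refine ⟨N, fun m hm hi => ?_⟩
      have := hN _ (key m hm) (by simp [hi])
      simp at this; omega
    · obtain ⟨N, hN⟩ := hF.2.2 (i - d s) (j - d t)
      refine ⟨N, fun m hm hi hj => ?_⟩
      have := hN _ (key m hm) (by simp [hi]) (by simp [hj])
      simp at this; omega

/-- The ordering of the exponents for series in `U((x₂))((x_t))((x_s))`. -/
def lexThree (s t : Fin 3) : (Fin 3 → ℤ) →+ ℤ ×ₗ ℤ ×ₗ ℤ :=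
  lexHom (Pi.evalAddMonoidHom _ s)
    (lexHom (Pi.evalAddMonoidHom _ t) (Pi.evalAddMonoidHom _ 2))

lemma lexThree_le {s t : Fin 3} {m n : Fin 3 → ℤ} : lexThree s t m ≤ lexThree s t n ↔
    m s < n s ∨ m s = n s ∧ (m t < n t ∨ m t = n t ∧ m 2 ≤ n 2) :=
  lexHom_le.trans (or_congr Iff.rfl (and_congr Iff.rfl lexHom_le))

lemma lexThree_injective {s t : Fin 3} (h : ∀ i, i = s ∨ i = t ∨ i = 2) :
    Function.Injective (lexThree s t) := by
  intro m n hmn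
  have h1 := lexThree_le.1 hmn.le
  have h2 := lexThree_le.1 hmn.ge
  ext i
  rcases h i with rfl | rfl | rfl <;> omega

lemma LexC.exists_min {s t : Fin 3} {F : (Fin 3 → ℤ) → U} (hF : LexC s t F)
    (T : Set (Fin 3 → ℤ)) (hT : ∀ m ∈ T, F m ≠ 0) (hne : T.Nonempty) :
    ∃ m ∈ T, ∀ m' ∈ T, lexThree s t m ≤ lexThree s t m' := by
  obtain ⟨⟨N, hN⟩, hF1, hF2⟩ := hF
  obtain ⟨a, ha, ha'⟩ := exists_forall_le_of_bddBelow (fun m : Fin 3 → ℤ => m s) hne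
    ⟨N, fun m hm => hN m (hT m hm)⟩
  obtain ⟨A, hA⟩ := hF1 (a s)
  obtain ⟨b, ⟨hb, hb0⟩, hb'⟩ := exists_forall_le_of_bddBelow (T := {m | m ∈ T ∧ m s = a s})
    (fun m : Fin 3 → ℤ => m t) ⟨a, ha, rfl⟩ ⟨A, fun m hm => hA m (hT m hm.1) hm.2⟩
  obtain ⟨B, hB⟩ := hF2 (a s) (b t)
  obtain ⟨c, ⟨hc, hc0, hc1⟩, hc'⟩ :=
    exists_forall_le_of_bddBelow (T := {m | m ∈ T ∧ m s = a s ∧ m t = b t})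
    (fun m : Fin 3 → ℤ => m 2) ⟨b, hb, hb0, rfl⟩ ⟨B, fun m hm => hB m (hT m hm.1) hm.2.1 hm.2.2⟩
  refine ⟨c, hc, fun m hm => lexThree_le.2 ?_⟩
  rcases lt_or_eq_of_le (ha' m hm) with h | h
  · left; rw [hc0]; exact h
  · right
    refine ⟨hc0.trans h, ?_⟩
    rcases lt_or_eq_of_le (hb' m ⟨hm, h.symm⟩) with h' | h'
    · left; rw [hc1]; exact h'
    · right; exact ⟨hc1.trans h', hc' m ⟨hm, h.symm, h'.symm⟩⟩

/-- Cancellation of a polynomial with a term free of `x₀` and `x₁` from an identity between a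
series in `U((x₂))((x₀))((x₁))` and a series in `U((x₂))((x₁))((x₀))`. -/
lemma LexC.cancel {u : MvPolynomial (Fin 3) ℂ} (hu : ∃ d ∈ u.support, d 0 = 0 ∧ d 1 = 0)
    {A B : (Fin 3 → ℤ) → U} (hA : LexC 1 0 A) (hB : LexC 0 1 B)
    (h : NonlocalVA.act u A = NonlocalVA.act u B) : A = B := by
  obtain ⟨e, he, he0, he1⟩ := hu
  have hu0 : u ≠ 0 := by rintro rfl; simp at he
  -- Comparison with the given term shows that the leading exponent of `u` is free of `x₀` and `x₁`
  -- for either order.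
  have lead : ∀ s t : Fin 3, (s = 0 ∧ t = 1 ∨ s = 1 ∧ t = 0) → ∃ d ∈ u.support, d 0 = 0 ∧
      d 1 = 0 ∧ ∀ e ∈ u.support, lexThree s t (expo d) ≤ lexThree s t (expo e) := by
    intro s t hst
    obtain ⟨d, hd, hmin⟩ := exists_lead (lexThree s t) hu0
    have := lexThree_le.1 (hmin e he)
    simp only [expo_apply] at this
    refine ⟨d, hd, ?_, ?_, hmin⟩ <;> rcases hst with ⟨rfl, rfl⟩ | ⟨rfl, rfl⟩ <;> omega
  obtain ⟨N, hN⟩ := hB.1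
  -- The product `u B = u A` has no power of `x₀` below `N`. As the leading term of `u` is free of
  -- `x₀`, cancellation on the region `m 0 < N` gives the same bound for `A`. This puts `A` in the
  -- space of `B`, where `A - B` can be cancelled.
  have hA0 : ∀ m, m 0 < N → A m = 0 := by
    obtain ⟨d, hd, hd0, -, hmin⟩ := lead 1 0 (Or.inr ⟨rfl, rfl⟩)
    refine act_cancel (Z := {m | m 0 < N}) (lexThree 1 0) (lexThree_injective (by decide))
      (fun T _ hT => hA.exists_min T hT) hd hmin (fun m hm e _ => ?_) fun m hm => ?_
    · simp only [Set.mem_ofPred_eq, Pi.add_apply, Pi.sub_apply, expo_apply, hd0] at hm ⊢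
      omega
    · by_contra hc
      rw [h] at hc
      obtain ⟨e, -, he⟩ := exists_act_ne_zero hc
      have := hN _ he
      simp only [Set.mem_ofPred_eq, Pi.add_apply, Pi.sub_apply, expo_apply, hd0] at hm this
      omega
  have hA' : LexC 0 1 A := by
    refine ⟨⟨N, fun m hm => ?_⟩, fun i => ?_, fun i j => ?_⟩
    · by_contra hc
      exact hm (hA0 m (by omega))
    · obtain ⟨M, hM⟩ := hA.1
      exact ⟨M, fun m hm _ => hM m hm⟩
    · obtain ⟨M, hM⟩ := hA.2.2 j i
      exact ⟨M, fun m hm hi hj => hM m hm hj hi⟩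
  have hD : LexC 0 1 (A + NonlocalVA.act (C (-1)) B) := hA'.add (hB.act _)
  obtain ⟨d, hd, -, -, hmin⟩ := lead 0 1 (Or.inl ⟨rfl, rfl⟩)
  have hD0 := act_cancel (Z := Set.univ) (lexThree 0 1) (lexThree_injective (by decide))
      (fun T _ hT => hD.exists_min T hT) hd hmin (fun _ _ _ _ => trivial) fun m _ => by
    rw [map_add, act_comm, h, act_C]
    simp
  ext m
  have := hD0 m trivial
  rw [act_C] at this
  simpa [← sub_eq_add_neg, sub_eq_zero] using this

/-- A variable acts by an invertible shift, so no condition on supports is needed. -/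
lemma act_X_pow_injective {σ : Type*} (s : σ) (k : ℕ) {F G : (σ → ℤ) → U}
    (h : act (X s ^ k) F = act (X s ^ k) G) : F = G := by
  classical
  induction k with
  | zero => simpa [act_one] using h
  | succ k ih =>
    rw [pow_succ', act_mul, act_mul] at h
    refine ih ?_
    ext m
    have := congrFun h (m + Pi.single s 1)
    simpa only [act_X, add_sub_cancel_right] using this

lemma slice_act_rename {σ : Type*} [DecidableEq σ] {s t : σ} (h : s ≠ t) (m : σ → ℤ)
    (q : MvPolynomial (Fin 2) ℂ) (F : (σ → ℤ) → U) :
    slice s t m (act (rename ![s, t] q) F) = act q (slice s t m F) := by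
  induction q using MvPolynomial.induction_on generalizing F with
  | C a => rw [rename_C, act_C, act_C]; rfl
  | add P Q hP hQ => rw [map_add (rename _), act_add, act_add, slice_add, hP, hQ]
  | mul_X P u hP =>
    rw [map_mul (rename _), act_mul, act_mul, hP, rename_X]
    congr 1
    fin_cases u
    · exact slice_X_left h m F
    · exact slice_X_right h m F

end Cancel

/-! ### The vertex algebra structure and the quasi module. -/

section VertexAlgebra

variable {W : Type*} [AddCommGroup W] [Module ℂ W] {V : Submodule ℂ (FieldSpace W)}

/-- `Y_𝓔` as a linear map. -/
lemma exists_vertexOperator (hV : Maximal (fun U : Submodule ℂ (FieldSpace W) =>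
      QuasiCompatible (U : Set (FieldSpace W))) V) :
    ∃ Y : V →ₗ[ℂ] FieldSpace V,
      (∀ a b : V, IsY 1 (a : FieldSpace W) b fun j => ((Y a b).coeff j : FieldSpace W)) ∧
      ∀ (a b : V) (n : ℤ), toSeries ((Y a b).coeff (-n - 1) : FieldSpace W) =
        modeProd 1 n (a : FieldSpace W) b := by
  choose y hy hmem hmode hb using fun a b : V => exists_isY_mem hV 1 a.2 b.2
  have hbdd : ∀ a b : V, BddBelow (Function.support fun j => (⟨y a b j, hmem a b j⟩ : V)) := by
    intro a b
    obtain ⟨N, hN⟩ := hb a b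
    refine ⟨N, fun j hj => ?_⟩
    by_contra hc
    exact hj (Subtype.ext (hN j (by omega)))
  let f : V → V → LaurentSeries V := fun a b => HahnSeries.ofSuppBddBelow _ (hbdd a b)
  have hf : ∀ a b j, ((f a b).coeff j : FieldSpace W) = y a b j := fun _ _ _ => rfl
  have ext : ∀ (g : LaurentSeries V) (a b : V),
      IsY 1 (a : FieldSpace W) b (fun j => (g.coeff j : FieldSpace W)) → f a b = g := by
    intro g a b hg
    ext1
    ext1 j
    exact Subtype.ext (congrFun ((hy a b).unique hg) j)
  refine ⟨LinearMap.mk₂ ℂ f ?_ ?_ ?_ ?_, fun a b => hy a b, fun a b n => hmode a b n⟩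
  · exact fun a a' b => ext _ _ _ ((hy a b).add_left (hy a' b))
  · exact fun c a b => ext _ _ _ ((hy a b).smul_left c)
  · exact fun a b b' => ext _ _ _ ((hy a b).add_right (hy a b'))
  · exact fun c a b => ext _ _ _ ((hy a b).smul_right c)

lemma prodSeries_three (a b c : FieldSpace W) (w : W) (m : Fin 3 → ℤ) :
    prodSeries ![a, b, c] w m = coeffEnd a (m 0) (coeffEnd b (m 1) (coeffEnd c (m 2) w)) := by
  simp [prodSeries, List.ofFn_succ]

lemma bddSnd_iterSeries {V : Type*} [AddCommGroup V] [Module ℂ V] (Y : V →ₗ[ℂ] FieldSpace W)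
    (u v : V) (w : W) : BddSnd (iterSeries Y u v w) := by
  obtain ⟨N, hN⟩ := field_laur (Y v) w
  refine ⟨N, fun m hm => hN _ fun h => hm ?_⟩
  rw [iterSeries, prodSeries_two, h, map_zero]

/-- The coefficient of `x ^ k` of a field in `V`, applied to a vector. -/
def coeffAt (V : Submodule ℂ (FieldSpace W)) (k : ℤ) (w : W) : V →ₗ[ℂ] W where
  toFun v := coeffEnd (v : FieldSpace W) k w
  map_add' u v := by simp [coeffEnd_add]
  map_smul' c v := by simp [coeffEnd_smul]

lemma lexC_nested (Y : V →ₗ[ℂ] FieldSpace V) (a b c : V) (w : W) :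
    LexC 0 1 fun m : Fin 3 → ℤ => coeffAt V (m 2) w (nestedSeries Y Y a b c ![m 0, m 1]) := by
  have key : ∀ m : Fin 3 → ℤ, coeffAt V (m 2) w (nestedSeries Y Y a b c ![m 0, m 1]) ≠ 0 →
      (Y ((Y a b).coeff (m 0)) c).coeff (m 1) ≠ 0 := fun m hm h => hm (by
    have : nestedSeries Y Y a b c ![m 0, m 1] = 0 := h
    rw [this, map_zero])
  refine ⟨?_, fun i => ?_, fun i j => ?_⟩
  · obtain ⟨N, hN⟩ := exists_coeff_bound (Y a b)
    refine ⟨N, fun m hm => hN _ fun h => key m hm ?_⟩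
    rw [h, map_zero]; rfl
  · obtain ⟨N, hN⟩ := exists_coeff_bound (Y ((Y a b).coeff i) c)
    refine ⟨N, fun m hm hi => hN _ ?_⟩
    subst hi
    exact key m hm
  · obtain ⟨N, hN⟩ := field_laur ((Y ((Y a b).coeff i) c).coeff j : FieldSpace W) w
    refine ⟨N, fun m hm hi hj => hN _ ?_⟩
    subst hi hj
    exact hm

/-- The powers of `x₁` in `Y(b, x₁)c` are bounded below, so a fixed power of `x₁` receives finitely
many terms of the expansion of `x₀ + x₁`, and their bounds have a minimum. -/
lemma lexC_iter (Y : V →ₗ[ℂ] FieldSpace V) (a b c : V) (w : W) :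
    LexC 1 0 fun m : Fin 3 → ℤ => coeffAt V (m 2) w
      (substAdd (iterSeries Y a b c) ![m 0, m 1]) := by
  obtain ⟨N, hN⟩ := exists_coeff_bound (Y b c)
  have key : ∀ m : Fin 3 → ℤ, coeffAt V (m 2) w (substAdd (iterSeries Y a b c) ![m 0, m 1]) ≠ 0 →
      ∃ p : ℕ, N ≤ m 1 - p ∧
        coeffAt V (m 2) w ((Y a ((Y b c).coeff (m 1 - p))).coeff (m 0 + p)) ≠ 0 := by
    intro m hm
    have h1 := congrFun (substAdd_comp (bddSnd_iterSeries Y a b c) (coeffAt V (m 2) w)) ![m 0, m 1]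
    rw [← h1] at hm
    obtain ⟨p, hp⟩ := exists_of_finsum_ne_zero hm
    have hp' := right_ne_zero_of_smul hp
    simp only [iterSeries, prodSeries_two, Matrix.cons_val_zero, Matrix.cons_val_one] at hp'
    refine ⟨p, hN _ fun h => hp' ?_, hp'⟩
    have : coeffEnd (Y b) (m 1 - p) c = 0 := h
    rw [this, map_zero, map_zero]
  choose N₀ hN₀ using fun n : ℤ => exists_coeff_bound (Y a ((Y b c).coeff n))
  choose N₂ hN₂ using fun i j : ℤ =>
    field_laur ((Y a ((Y b c).coeff j)).coeff i : FieldSpace W) w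
  refine ⟨⟨N, fun m hm => ?_⟩, fun i => ?_, fun i j => ?_⟩
  · obtain ⟨p, hp, -⟩ := key m hm
    omega
  · obtain ⟨K, hK⟩ := ((Finset.range ((i - N).toNat + 1)).image
      fun p : ℕ => N₀ (i - p) - p).bddBelow
    refine ⟨K, fun m hm hi => ?_⟩
    obtain ⟨p, hp, h⟩ := key m hm
    subst hi
    have h2 : N₀ (m 1 - p) ≤ m 0 + p := hN₀ _ _ fun h0 => h (by rw [h0, map_zero])
    have h3 := hK (Finset.mem_image_of_mem (fun p : ℕ => N₀ (m 1 - p) - (p : ℤ))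
      (Finset.mem_range.2 (by omega : p < (m 1 - N).toNat + 1)))
    omega
  · obtain ⟨K, hK⟩ := ((Finset.range ((i - N).toNat + 1)).image
      fun p : ℕ => N₂ (j + p) (i - p)).bddBelow
    refine ⟨K, fun m hm hi hj => ?_⟩
    obtain ⟨p, hp, h⟩ := key m hm
    subst hi hj
    have h3 := hK (Finset.mem_image_of_mem (fun p : ℕ => N₂ (m 0 + p) (m 1 - p))
      (Finset.mem_range.2 (by omega : p < (m 1 - N).toNat + 1)))
    exact h3.trans (hN₂ _ _ _ h)

lemma Laur.slice_substVar {σ : Type*} [DecidableEq σ] {U : Type*} [AddCommGroup U] [Module ℂ U]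
    {F : (σ → ℤ) → U} (hF : Laur F) (α : ℂˣ) {r s t t' : σ} (hrt' : r ≠ t') (hst : s ≠ t)
    (hrs : r ≠ s) (hrt : r ≠ t) (m : σ → ℤ) :
    Laur (NonlocalVA.slice s t m (substVar α r t' F)) := by
  obtain ⟨N, hN⟩ := hF.substVar_coeff α hrt' (m r)
  refine ⟨N, fun n hn i => ?_⟩
  have h := hN _ (by simp [hrs, hrt]) hn
  fin_cases i
  · simpa [hst] using h s hrs.symm
  · simpa using h t hrt.symm

/-- The polynomials that regularize a triple give an identity between `Y(a, x₀ + x₁)Y(b, x₁)c`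
and `Y(Y(a, x₀)b, x₁)c`. -/
lemma act_assoc {Y : V →ₗ[ℂ] FieldSpace V}
    (hY : ∀ a b : V, IsY 1 (a : FieldSpace W) b fun j => ((Y a b).coeff j : FieldSpace W))
    (hV : QuasiCompatible (V : Set (FieldSpace W))) (a b c : V) :
    ∃ f : MvPolynomial (Fin 2) ℂ, f ≠ 0 ∧ ∀ w : W,
      act (tau 1 1 2 (tau 1 0 1 (pairProd 3 f))) (fun m : Fin 3 → ℤ => coeffAt V (m 2) w
        (substAdd (iterSeries Y a b c) ![m 0, m 1])) =
      act (tau 1 1 2 (tau 1 0 1 (pairProd 3 f))) (fun m : Fin 3 → ℤ => coeffAt V (m 2) w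
        (nestedSeries Y Y a b c ![m 0, m 1])) := by
  obtain ⟨f, hf, hfL⟩ := hV 3 ![a, b, c] fun i => by fin_cases i <;> simp
  refine ⟨f, hf, fun w => ?_⟩
  set G : (Fin 3 → ℤ) → W := prodSeries ![(a : FieldSpace W), b, c] w with hG
  set P := pairProd 3 f with hP
  have hF : Laur (act P G) := by
    have := hfL w
    rwa [polyMul_eq_act] at this
  set F := act P G with hFdef
  -- `J` and `I` apply `Y_𝓔` to `b, c` and then to `a`; `L` and `B` apply it to `a, b` and then with
  -- `c`. Both chains start from the product `G`.
  let J : (Fin 3 → ℤ) → W := fun m => coeffEnd (a : FieldSpace W) (m 0)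
    (coeffEnd ((Y b c).coeff (m 1) : FieldSpace W) (m 2) w)
  let I : (Fin 3 → ℤ) → W := fun m =>
    coeffEnd ((Y a ((Y b c).coeff (m 1))).coeff (m 0) : FieldSpace W) (m 2) w
  let L : (Fin 3 → ℤ) → W := fun m =>
    coeffEnd ((Y a b).coeff (m 0) : FieldSpace W) (m 1) (coeffEnd (c : FieldSpace W) (m 2) w)
  let B : (Fin 3 → ℤ) → W := fun m =>
    coeffEnd ((Y ((Y a b).coeff (m 0)) c).coeff (m 1) : FieldSpace W) (m 2) w
  have h12 : (1 : Fin 3) ≠ 2 := by decide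
  have h02 : (0 : Fin 3) ≠ 2 := by decide
  have h01 : (0 : Fin 3) ≠ 1 := by decide
  have hGJ : LiftRel 1 2 (IsT2 1) G J := fun m => by
    convert (hY b c w).comp (coeffEnd (a : FieldSpace W) (m 0)) using 1
    · ext n; simp [slice, hG, prodSeries_two, prodSeries_three]
    · ext n; simp [slice, J]
  have hJI : LiftRel 0 2 (IsT2 1) J I := fun m => by
    convert hY a ((Y b c).coeff (m 1)) w using 1
    · ext n; simp [slice, J, prodSeries_two]
    · ext n; simp [slice, I]
  have hGL : LiftRel 0 1 (IsT2 1) G L := fun m => by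
    convert hY a b (coeffEnd (c : FieldSpace W) (m 2) w) using 1
    · ext n; simp [slice, hG, prodSeries_two, prodSeries_three]
    · ext n; simp [slice, L]
  have hLB : LiftRel 1 2 (IsT2 1) L B := fun m => by
    convert hY ((Y a b).coeff (m 0)) c w using 1
    · ext n; simp [slice, L, prodSeries_two]
    · ext n; simp [slice, B]
  have eJ : act (tau 1 1 2 P) J = substVar 1 1 2 F :=
    hGJ.eq_substVar h12 fun m => hF.slice h12 m
  have eI : act (tau 1 0 2 (tau 1 1 2 P)) I = substVar 1 0 2 (substVar 1 1 2 F) := by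
    have := hJI.eq_substVar h02 (P := tau 1 1 2 P) fun m => by
      rw [eJ]; exact hF.slice_substVar 1 h12 h02 h01.symm h12 m
    rwa [eJ] at this
  have eL : act (tau 1 0 1 P) L = substVar 1 0 1 F :=
    hGL.eq_substVar h01 fun m => hF.slice h01 m
  have eB : act (tau 1 1 2 (tau 1 0 1 P)) B = substVar 1 1 2 (substVar 1 0 1 F) := by
    have := hLB.eq_substVar h12 (P := tau 1 0 1 P) fun m => by
      rw [eL]; exact hF.slice_substVar 1 h01 h12 h01 h02 m
    rwa [eL] at this
  -- It remains to pass from `Y(a, x₀)Y(b, x₁)c` to `Y(a, x₀ + x₁)Y(b, x₁)c`, which is the other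
  -- kind of expansion.
  have hIA : LiftRel 0 1 IsSubstAdd I fun m : Fin 3 → ℤ => coeffAt V (m 2) w
      (substAdd (iterSeries Y a b c) ![m 0, m 1]) := fun m => by
    have e : slice 0 1 m I = fun n => coeffAt V (m 2) w (iterSeries Y a b c n) := by
      ext n
      simp only [slice, I, iterSeries, prodSeries_two]
      simp
      rfl
    refine ⟨?_, ?_⟩
    · rw [e]
      obtain ⟨N, hN⟩ := bddSnd_iterSeries Y a b c
      exact ⟨N, fun n hn => hN n fun h => hn ((congrArg _ h).trans (map_zero _))⟩
    · rw [e, substAdd_comp (bddSnd_iterSeries Y a b c)]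
      ext n
      simp only [slice]
      congr 2
  have eA := hIA.act h01 semilin_isSubstAdd (tau 1 0 2 (tau 1 1 2 P))
  -- Both chains send `x₀` to `x₀ + x₁ + x₂` and `x₁` to `x₁ + x₂`, so the same polynomial
  -- multiplies both sides.
  have hτ : tau (1 : ℂ) (0 : Fin 3) 1 (tau 1 0 2 (tau 1 1 2 P)) = tau 1 1 2 (tau 1 0 1 P) := by
    have : ((tau (1 : ℂ) (0 : Fin 3) 1).comp (tau 1 0 2)).comp (tau 1 1 2) =
        (tau 1 1 2).comp (tau 1 0 1) := by
      ext u : 1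
      fin_cases u <;> simp [tau_X_of_ne]
      ring
    exact DFunLike.congr_fun this P
  rw [hτ] at eA
  have eA' : act (tau 1 1 2 (tau 1 0 1 P)) (fun m : Fin 3 → ℤ => coeffAt V (m 2) w
      (substAdd (iterSeries Y a b c) ![m 0, m 1])) =
      addVar 0 1 (act (tau 1 0 2 (tau 1 1 2 P)) I) := by
    ext m
    rw [addVar, ← (eA m).2, slice_self]
  rw [eA', eI, addVar_substVar hF, ← eB]
  rfl

lemma weak_assoc_of_isY {Y : V →ₗ[ℂ] FieldSpace V}
    (hY : ∀ a b : V, IsY 1 (a : FieldSpace W) b fun j => ((Y a b).coeff j : FieldSpace W))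
    (hV : QuasiCompatible (V : Set (FieldSpace W))) (a b c : V) : ∃ l : ℕ,
    polyMul ((X 0 + X 1) ^ l) (substAdd (iterSeries Y a b c)) =
      polyMul ((X 0 + X 1) ^ l) (nestedSeries Y Y a b c) := by
  obtain ⟨f, hf, h⟩ := act_assoc hY hV a b c
  obtain ⟨k, u, hu, e⟩ := exists_tau_pairProd hf
  -- The exponent comes from `f`, which regularizes the triple for all `w`; hence one `l` serves the
  -- `V`-valued identity, which is tested coefficientwise on vectors of `W`.
  refine ⟨k, ?_⟩
  rw [polyMul_eq_act, polyMul_eq_act]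
  have key : ∀ w : W, act ((X 0 + X 1) ^ k) (fun m : Fin 3 → ℤ => coeffAt V (m 2) w
        (substAdd (iterSeries Y a b c) ![m 0, m 1])) =
      act ((X 0 + X 1) ^ k) (fun m : Fin 3 → ℤ => coeffAt V (m 2) w
        (nestedSeries Y Y a b c ![m 0, m 1])) := by
    intro w
    have h1 := h w
    have e' : ∀ F : (Fin 3 → ℤ) → W, act (tau 1 1 2 (tau 1 0 1 (pairProd 3 f))) F =
        act (X 0 ^ k) (act (X 1 ^ k) (act u (act ((X 0 + X 1) ^ k) F))) := fun F => by
      rw [e, act_mul, act_mul, act_mul]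
    rw [e', e'] at h1
    have h2 := act_X_pow_injective 1 k (act_X_pow_injective 0 k h1)
    exact LexC.cancel hu ((lexC_iter Y a b c w).act _) ((lexC_nested Y a b c w).act _) h2
  have hs : ∀ (S : (Fin 2 → ℤ) → V) (n : Fin 2 → ℤ) (j : ℤ) (w : W),
      coeffAt V j w (act ((X 0 + X 1) ^ k) S n) = act ((X 0 + X 1) ^ k)
        (fun m : Fin 3 → ℤ => coeffAt V (m 2) w (S ![m 0, m 1])) ![n 0, n 1, j] := by
    intro S n j w
    have h01 : (0 : Fin 3) ≠ 1 := by decide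
    have h1 := slice_act_rename h01 ![n 0, n 1, j] ((X 0 + X 1) ^ k)
      (fun m : Fin 3 → ℤ => coeffAt V (m 2) w (S ![m 0, m 1]))
    have h2 : rename ![(0 : Fin 3), 1] ((X 0 + X 1 : MvPolynomial (Fin 2) ℂ) ^ k) =
        (X 0 + X 1) ^ k := by simp
    have h3 : slice 0 1 ![n 0, n 1, j] (fun m : Fin 3 → ℤ => coeffAt V (m 2) w (S ![m 0, m 1])) =
        fun n => coeffAt V j w (S n) := by
      ext n'
      simp only [slice]
      congr 2
      ext u; fin_cases u <;> simp
    rw [h2, h3] at h1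
    have h4 := congrFun (h1.trans (act_comp (coeffAt V j w) ((X 0 + X 1) ^ k) S)) n
    refine h4.symm.trans ?_
    have h5 : (![n 0, n 1] : Fin 2 → ℤ) = n := by ext u; fin_cases u <;> rfl
    have h6 := slice_self (0 : Fin 3) 1 ![n 0, n 1, j] (act ((X 0 + X 1) ^ k)
      (fun m : Fin 3 → ℤ => coeffAt V (m 2) w (S ![m 0, m 1])))
    rw [← h6]
    congr 1
    exact h5.symm
  ext1 n
  refine Subtype.ext (field_ext fun w j => ?_)
  have h1 := hs (substAdd (iterSeries Y a b c)) n j w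
  have h2 := hs (nestedSeries Y Y a b c) n j w
  rw [key] at h1
  exact h1.trans h2.symm

lemma quasi_assoc_of_isY {Y : V →ₗ[ℂ] FieldSpace V}
    (hY : ∀ a b : V, IsY 1 (a : FieldSpace W) b fun j => ((Y a b).coeff j : FieldSpace W))
    (hV : QuasiCompatible (V : Set (FieldSpace W))) (a b : V) (w : W) :
    ∃ f : MvPolynomial (Fin 2) ℂ, f ≠ 0 ∧
      polyMul (aeval ![X 0 + X 1, X 1] f) (substAdd (iterSeries V.subtype a b w)) =
        polyMul (aeval ![X 0 + X 1, X 1] f) (nestedSeries Y V.subtype a b w) := by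
  obtain ⟨p, hp, h⟩ := exists_regularizes hV a.2 b.2
  have hL := h w
  rw [polyMul_eq_act] at hL
  obtain ⟨N, hN⟩ := hL
  have hL : Laur (act p (prodSeries ![(a : FieldSpace W), b] w)) := ⟨N, hN⟩
  -- The power of `x₁` removes the negative powers that remain after `p`. It depends on `w`, as the
  -- quasi module axiom permits.
  set f : MvPolynomial (Fin 2) ℂ := X 0 ^ (-N).toNat * p with hf
  have hF : ∀ m, act f (prodSeries ![(a : FieldSpace W), b] w) m ≠ 0 → 0 ≤ m 0 := by
    intro m hm
    rw [hf, act_mul, X_pow_eq_monomial, act_monomial, one_smul] at hm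
    have := hN _ hm 0
    simp at this
    omega
  have hτ : aeval ![X 0 + X 1, X 1] f = tau 1 0 1 f := by
    congr 1
    ext u : 1
    fin_cases u
    · simp [add_comm]
    · simp [tau_X_of_ne]
  refine ⟨f, mul_ne_zero (pow_ne_zero _ (X_ne_zero 0)) hp, ?_⟩
  have hT := (hY a b w).act f
  have hLf : Laur (act f (prodSeries ![(a : FieldSpace W), b] w)) := by
    rw [hf, act_mul]; exact hL.act _
  rw [polyMul_eq_act, polyMul_eq_act, hτ, ← substAdd_act (bddSnd_iterSeries _ a b w)]
  change substAdd (act f (prodSeries ![(a : FieldSpace W), b] w)) = _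
  rw [substAdd_eq_sub2 hF]
  exact ((hLf.isT2 1).unique hT)

end VertexAlgebra

end NonlocalVA

theorem theorem2p19 {W : Type*} [AddCommGroup W] [Module ℂ W]
    (V : Submodule ℂ (NonlocalVA.FieldSpace W))
    (hV : Maximal (fun U : Submodule ℂ (NonlocalVA.FieldSpace W) =>
      NonlocalVA.QuasiCompatible (U : Set (NonlocalVA.FieldSpace W))) V) :
    NonlocalVA.idField W ∈ V ∧
    NonlocalVA.ClosedUnderModes V ∧
    (∃ A : NonlocalVA.NonlocalVertexAlgebra V,
      (∀ (a b : V) (n : ℤ),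
        NonlocalVA.toSeries ((A.Y a b).coeff (-n - 1) : NonlocalVA.FieldSpace W) =
          NonlocalVA.modeProd 1 n (a : NonlocalVA.FieldSpace W) b) ∧
      (A.one : NonlocalVA.FieldSpace W) = NonlocalVA.idField W ∧
      ∃ M : NonlocalVA.QuasiModule A W,
        (∀ ψ : V, M.Y ψ = (ψ : NonlocalVA.FieldSpace W)) ∧ M.Faithful) ∧
    (∀ a ∈ V, ∀ α : ℂˣ, NonlocalVA.rescale α a ∈ V) ∧
    (∀ a ∈ V, ∀ b ∈ V, ∀ (α : ℂˣ) (n : ℤ),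
      NonlocalVA.modeProd α n a b ∈
        NonlocalVA.toSeries '' (V : Set (NonlocalVA.FieldSpace W))) := by
  open NonlocalVA in
  have hone : idField W ∈ V := mem_of_adjoinable hV adjoinable_id
  have hmode : ∀ a ∈ V, ∀ b ∈ V, ∀ (α : ℂˣ) (n : ℤ),
      modeProd α n a b ∈ toSeries '' (V : Set (FieldSpace W)) := by
    intro a ha b hb α n
    obtain ⟨y, -, hmem, hy, -⟩ := exists_isY_mem hV α ha hb
    exact ⟨_, hmem (-n - 1), hy n⟩
  obtain ⟨Y, hY, hYmode⟩ := exists_vertexOperator hV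
  refine ⟨hone, fun a ha b hb n => hmode a ha b hb 1 n, ?_, fun a ha α => ?_, hmode⟩
  · refine ⟨⟨Y, ⟨idField W, hone⟩, fun v => ?_, fun v n hn => ?_, fun v => ?_,
      weak_assoc_of_isY hY hV.1⟩, hYmode, rfl, ⟨V.subtype, rfl, quasi_assoc_of_isY hY hV.1⟩,
      fun ψ => rfl, Subtype.val_injective⟩
    · ext1
      ext1 n
      have := congrFun ((hY ⟨idField W, hone⟩ v).unique (isY_id_left (v : FieldSpace W))) n
      refine Subtype.ext (this.trans ?_)
      rw [HahnSeries.coeff_single]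
      split_ifs <;> rfl
    · exact Subtype.ext (isY_id_right_of_neg (hY v ⟨idField W, hone⟩) hn)
    · exact Subtype.ext ((isY_id_right_zero (hY v ⟨idField W, hone⟩)).trans (rescale_one _))
  · obtain ⟨y, hy, hmem, -, -⟩ := exists_isY_mem hV α ha hone
    rw [← isY_id_right_zero hy]
    exact hmem 0

end
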